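/- Let $n\ge 1$ and let $u:\mathbb{R}^n\to[0,\infty)$ be a global classical solution of the one-phase free boundary problem, with positive phase $\Omega=\{u>0\}$ and free boundary $F(u)=\partial\Omega$. That is: $u\ge 0$ is continuous; $F(u)$ is a smooth hypersurface with $u>0$ on one side and $u=0$ on the other; $u\in C^\infty(\overline{\Omega})$ is harmonic in $\Omega$; and $|\nabla u|=1$ on $F(u)$, the gradient being taken from the positive side. Let $H$ be the mean curvature (sum of the principal curvatures) of $F(u)$ with respect to the outer unit normal $\nu=-\nabla u$, with the sign for which $H=\operatorname{div}(\nabla u/|\nabla u|)$ on $F(u)$. For $\phi,\psi\in C_c^\infty(\overline{\Omega})$ put $$Q(\phi,\psi)=\int_{\Omega}\nabla\phi\cdot\nabla\psi\,dx-\int_{F(u)}H\,\phi\,\psi\,d\mathcal{H}^{n-1},$$ and let $\operatorname{ind}(u)\in\{0,1,2,\dots\}\cup\{\infty\}$ be the supremum of the dimensions of the subspaces of $C_c^\infty(\overline{\Omega})$ on which $Q$ is negative definite. Let $H^1_{F,\mathrm{loc}}(\Omega)$ be the space of functions on $\Omega$ that are limits of some sequence in $C_c^\infty(\overline{\Omega})$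 which converges in $H^1(\Omega\cap B_R)$, and whose boundary values converge in $L^2(F(u)\cap B_R)$, for every $R>0$; the limit $T\varphi$ of the boundary values is the trace of $\varphi$ on $F(u)$. An $L^2(\Omega)$ Robin eigenfunction with eigenvalue $\lambda\in\mathbb{R}$ is a nonzero $\varphi\in L^2(\Omega)\cap H^1_{F,\mathrm{loc}}(\Omega)$ that solves $$-\Delta\varphi=\lambda\varphi\ \text{ in }\Omega,\qquad \varphi_\nu-H\varphi=0\ \text{ on }F(u)$$ in the weak sense $$\int_{\Omega}\nabla\varphi\cdot\nabla\psi\,dx-\int_{F(u)}H\,(T\varphi)\,\psi\,d\mathcal{H}^{n-1}=\lambda\int_\Omega\varphi\,\psi\,dx\qquad\text{for all }\psi\in C_c^\infty(\overline{\Omega}).$$ Assume that $\Omega$ is connected (and nonempty). Then the following are equivalent: (i) $\operatorname{ind}(u)<\infty$; (ii) there is a finite-dimensional subspace $V\subseteq L^2(\Omega)$, spanned by a finite (possibly empty) $L^2(\Omega)$-orthonormal set $\{\varphi_i\}_{i=1}^k$ of Robin eigenfunctions with negative eigenvalues $\lambda_1,\dots,\lambda_k$, such that $Q(\psi,\psi)\ge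 0$ for all $\psi\in C_c^\infty(\overline{\Omega})$ whose restriction to $\Omega$ is $L^2(\Omega)$-orthogonal to $V$. Moreover, if $\operatorname{ind}(u)<\infty$, then $\operatorname{ind}(u)=\dim V$ for every $V$ as in (ii). -/

import Mathlib

open MeasureTheory Set Filter
open scoped Topology ENNReal ContDiff Gradient RealInnerProductSpace

noncomputable section

namespace OnePhase

/-- The positive phase `Ω = {u > 0}`. -/
def posPhase {n : ℕ} (u : EuclideanSpace ℝ (Fin n) → ℝ) : Set (EuclideanSpace ℝ (Fin n)) :=
  {x | 0 < u x}

/-- The free boundary `F(u) = ∂{u > 0}`. -/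
def freeBdry {n : ℕ} (u : EuclideanSpace ℝ (Fin n) → ℝ) : Set (EuclideanSpace ℝ (Fin n)) :=
  frontier (posPhase u)

/-- Global classical solutions of the one-phase free boundary problem on `ℝⁿ`.
Smoothness "up to the boundary" on `closure Ω` is `ContDiffOn ℝ ∞ · (closure Ω)`; derivatives at
points of `F(u)` are derivatives within `closure Ω`, i.e. taken from the positive side (they are
unique, since `Ω` lies locally on one side of a smooth hypersurface). -/
structure IsGlobalClassicalSolution {n : ℕ} (u : EuclideanSpace ℝ (Fin n) → ℝ) : Prop where
  nonneg : ∀ x, 0 ≤ u x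
  continuous : Continuous u
  /-- `F(u)` is a smooth hypersurface, with `u > 0` on one side and `u = 0` on the other: near each
  of its points there is a smooth defining function `w` with nonzero gradient such that
  `{u > 0} = {w > 0}`. -/
  smooth_freeBdry : ∀ p ∈ freeBdry u, ∃ (w : EuclideanSpace ℝ (Fin n) → ℝ)
    (U : Set (EuclideanSpace ℝ (Fin n))), IsOpen U ∧ p ∈ U ∧ ContDiffOn ℝ ∞ w U ∧
      (∀ x ∈ U, ∇ w x ≠ 0) ∧ ∀ x ∈ U, (0 < u x ↔ 0 < w x)
  smooth_up_to_bdry : ContDiffOn ℝ ∞ u (closure (posPhase u))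
  harmonic : InnerProductSpace.HarmonicOnNhd u (posPhase u)
  norm_gradient : ∀ p ∈ freeBdry u, ‖gradientWithin u (closure (posPhase u)) p‖ = 1

/-- The vector field `-∇u` on `closure Ω`; on `F(u)` it is the outer unit normal `ν`. -/
def outerNormal {n : ℕ} (u : EuclideanSpace ℝ (Fin n) → ℝ) (x : EuclideanSpace ℝ (Fin n)) :
    EuclideanSpace ℝ (Fin n) :=
  -gradientWithin u (closure (posPhase u)) x

/-- The mean curvature `H` of `F(u)` with respect to the outer unit normal `ν = -∇u`, i.e. the sum
of the principal curvatures: the trace of the shape operator `-Dν` over the tangent space `ν^⊥`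
(the trace over `ℝⁿ` minus the contribution of the direction `ν`). Equivalently,
`H = div (∇u / |∇u|)` on `F(u)`; it is positive where the complement of `Ω` is strictly convex. -/
def meanCurvature {n : ℕ} (u : EuclideanSpace ℝ (Fin n) → ℝ) (p : EuclideanSpace ℝ (Fin n)) : ℝ :=
  -(LinearMap.trace ℝ (EuclideanSpace ℝ (Fin n))
        (fderivWithin ℝ (outerNormal u) (closure (posPhase u)) p).toLinearMap
      - ⟪fderivWithin ℝ (outerNormal u) (closure (posPhase u)) p (outerNormal u p),
          outerNormal u p⟫)

/-- Lebesgue measure on the positive phase. -/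
def phaseMeasure {n : ℕ} (u : EuclideanSpace ℝ (Fin n) → ℝ) :
    Measure (EuclideanSpace ℝ (Fin n)) :=
  volume.restrict (posPhase u)

/-- The `(n-1)`-dimensional Hausdorff measure (normalized as surface area) on the free boundary. -/
def bdryMeasure {n : ℕ} (u : EuclideanSpace ℝ (Fin n) → ℝ) :
    Measure (EuclideanSpace ℝ (Fin n)) :=
  (Measure.euclideanHausdorffMeasure (n - 1)).restrict (freeBdry u)

/-- `C^∞_c(closure Ω)`: functions on `closure Ω` that are smooth up to the boundary and have compact
support. A function on `closure Ω` is represented by its extension by zero to `ℝⁿ`. -/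
def testFunctions {n : ℕ} (u : EuclideanSpace ℝ (Fin n) → ℝ) :
    Submodule ℝ (EuclideanSpace ℝ (Fin n) → ℝ) where
  carrier := {φ | ContDiffOn ℝ ∞ φ (closure (posPhase u)) ∧ HasCompactSupport φ ∧
    ∀ x ∉ closure (posPhase u), φ x = 0}
  add_mem' := fun ha hb =>
    ⟨ha.1.add hb.1, ha.2.1.add hb.2.1, fun x hx => by simp [ha.2.2 x hx, hb.2.2 x hx]⟩
  zero_mem' := ⟨contDiffOn_const, HasCompactSupport.zero, fun _ _ => rfl⟩
  smul_mem' := fun c f hf =>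
    ⟨contDiffOn_const.smul hf.1, hf.2.1.smul_left (f := fun _ => c),
      fun x hx => by simp [hf.2.2 x hx]⟩

/-- The second variation form
`Q(φ, ψ) = ∫_Ω ∇φ · ∇ψ dx - ∫_{F(u)} H φ ψ dℋⁿ⁻¹` on `C^∞_c(closure Ω)`. -/
def secondVariation {n : ℕ} (u φ ψ : EuclideanSpace ℝ (Fin n) → ℝ) : ℝ :=
  (∫ x, ⟪∇ φ x, ∇ ψ x⟫ ∂(phaseMeasure u)) - ∫ x, meanCurvature u x * φ x * ψ x ∂(bdryMeasure u)

/-- The Morse index: the supremum of the dimensions of the subspaces of `C^∞_c(closure Ω)` on which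
`Q` is negative definite. -/
def morseIndex {n : ℕ} (u : EuclideanSpace ℝ (Fin n) → ℝ) : ℕ∞ :=
  ⨆ (V : Submodule ℝ (EuclideanSpace ℝ (Fin n) → ℝ))
    (_ : V ≤ testFunctions u ∧ ∀ φ ∈ V, φ ≠ 0 → secondVariation u φ φ < 0),
    Cardinal.toENat (Module.rank ℝ V)

/-- The real Hilbert space `L²(Ω)`. -/
abbrev L2Phase {n : ℕ} (u : EuclideanSpace ℝ (Fin n) → ℝ) : Type :=
  Lp ℝ 2 (phaseMeasure u)

/-- `φ` lies in the local Sobolev space `H¹_{F,loc}(Ω)`, with gradient `G` and trace `T` on `F(u)`: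
on every ball, `φ` is the `H¹`-limit of functions of `C^∞_c(closure Ω)`, `G` is the `L²`-limit of
their gradients and `T` the `L²`-limit of their boundary values. -/
def HasLocalGradientTrace {n : ℕ} (u φ : EuclideanSpace ℝ (Fin n) → ℝ)
    (G : EuclideanSpace ℝ (Fin n) → EuclideanSpace ℝ (Fin n))
    (T : EuclideanSpace ℝ (Fin n) → ℝ) : Prop :=
  (∀ R : ℝ, MemLp φ 2 ((phaseMeasure u).restrict (Metric.ball 0 R)) ∧
    MemLp G 2 ((phaseMeasure u).restrict (Metric.ball 0 R)) ∧
    MemLp T 2 ((bdryMeasure u).restrict (Metric.ball 0 R))) ∧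
  ∃ f : ℕ → EuclideanSpace ℝ (Fin n) → ℝ, (∀ m, f m ∈ testFunctions u) ∧ ∀ R : ℝ,
    Tendsto (fun m => eLpNorm (fun x => f m x - φ x) 2
      ((phaseMeasure u).restrict (Metric.ball 0 R))) atTop (𝓝 0) ∧
    Tendsto (fun m => eLpNorm (fun x => ∇ (f m) x - G x) 2
      ((phaseMeasure u).restrict (Metric.ball 0 R))) atTop (𝓝 0) ∧
    Tendsto (fun m => eLpNorm (fun x => f m x - T x) 2
      ((bdryMeasure u).restrict (Metric.ball 0 R))) atTop (𝓝 0)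

/-- `φ ∈ L²(Ω)` is an eigenfunction, with eigenvalue `l`, of the Robin problem
`-Δφ = l φ` in `Ω`, `φ_ν - H φ = 0` on `F(u)`, in the weak sense: `φ ≠ 0`, `φ ∈ H¹_{F,loc}(Ω)` and
`Q(φ, ψ) = l ⟨φ, ψ⟩` in `L²(Ω)` for all `ψ ∈ C^∞_c(closure Ω)`. -/
def IsRobinEigenfunction {n : ℕ} (u : EuclideanSpace ℝ (Fin n) → ℝ) (φ : L2Phase u) (l : ℝ) :
    Prop :=
  φ ≠ 0 ∧ ∃ (G : EuclideanSpace ℝ (Fin n) → EuclideanSpace ℝ (Fin n))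
    (T : EuclideanSpace ℝ (Fin n) → ℝ), HasLocalGradientTrace u φ G T ∧
    ∀ ψ ∈ testFunctions u,
      (∫ x, ⟪G x, ∇ ψ x⟫ ∂(phaseMeasure u)) - ∫ x, meanCurvature u x * T x * ψ x ∂(bdryMeasure u)
        = l * ∫ x, φ x * ψ x ∂(phaseMeasure u)

/-- `V ⊆ L²(Ω)` is the span of a finite orthonormal set of Robin eigenfunctions with negative
eigenvalues. -/
def IsNegativeEigenspan {n : ℕ} (u : EuclideanSpace ℝ (Fin n) → ℝ)
    (V : Submodule ℝ (L2Phase u)) : Prop :=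
  ∃ (k : ℕ) (φ : Fin k → L2Phase u) (l : Fin k → ℝ), Orthonormal ℝ φ ∧
    (∀ i, l i < 0 ∧ IsRobinEigenfunction u (φ i) (l i)) ∧ V = Submodule.span ℝ (Set.range φ)

/-- `Q(ψ, ψ) ≥ 0` for all `ψ ∈ C^∞_c(closure Ω)` whose restriction to `Ω` is `L²(Ω)`-orthogonal
to `V`. -/
def IsNonnegOnOrthogonal {n : ℕ} (u : EuclideanSpace ℝ (Fin n) → ℝ)
    (V : Submodule ℝ (L2Phase u)) : Prop :=
  ∀ ψ ∈ testFunctions u, (∀ v ∈ V, ∫ x, v x * ψ x ∂(phaseMeasure u) = 0) →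
    0 ≤ secondVariation u ψ ψ

end OnePhase

end

/-! The point is that finite index makes `Q` semibounded on all of `Ω`, after which the spectral
theory of a form with finitely many negative directions applies. Take a maximal finite tuple of test
functions with negative definite Gram matrix. By maximality `Q` is nonnegative on its `Q`-orthogonal
complement, in particular on every test function that vanishes on a ball containing all the
supports. Inside a larger ball Gårding's inequality holds: `H` is bounded there, and the trace
inequality controls boundary values with an arbitrarily small multiple of the Dirichlet energy
(`exists_trace_inequality`, `exists_garding`). A partition of unity `η² + ζ² = 1` glues the two
regions, its cost being `∫ (|∇η|² + |∇ζ|²) φ²`, so `Q ≥ -C ‖·‖²` (`exists_lower_bound`). Hence `Q +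
c ‖·‖²` with `c = C + 1` is a scalar product. In its completion `Q` is represented by a bounded
symmetric operator `A = 1 - c J*J`, `J` being the extension of the map to `L²(Ω)`, and `A` still has
finite negative index. For such an operator the minimum of the Rayleigh quotient is attained when it
is negative (`exists_negative_eigenvector`): a minimizing sequence splits into a finite-dimensional
part, compact by Bolzano–Weierstrass, and a part on which `A ≥ 0`, which is forced to be Cauchy.
Splitting off eigenvectors ends after finitely many steps, and their images under `J` are the
eigenfunctions. The form norm controls gradients and traces on balls (`exists_local_coercivity`), so
these images lie in `H¹_{F,loc}(Ω)` and solve the Robin problem weakly. For the index formula,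
pairing with a basis of `V` is injective on every negative subspace, so the index is at most `dim
V`. Conversely, cutoffs of approximations of the `φ i` have a Gram matrix for `Q` close to the
diagonal matrix of the `λ i`, because the error `∫ |∇η|² φ i φ j` tends to zero for `φ i, φ j` in
`L²`; negative definiteness is an open condition, so the index is at least `dim V`. -/

open MeasureTheory Set Filter
open scoped Topology ENNReal ContDiff Gradient RealInnerProductSpace NNReal

/-! ### Surface measure of Lipschitz graphs and slicing along lines. -/

section GraphMeasure

variable {E : Type*} [NormedAddCommGroup E] [InnerProductSpace ℝ E] [FiniteDimensional ℝ E]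
  [MeasurableSpace E] [BorelSpace E]

/-- Slicing an integral over `E` along the lines parallel to a unit vector. -/
theorem lintegral_lintegral_add_smul_unit {e : E} (he : ‖e‖ = 1) {g : E → ℝ≥0∞}
    (hg : Measurable g) :
    ∫⁻ y : ((ℝ ∙ e)ᗮ : Submodule ℝ E), ∫⁻ t : ℝ, g ((y : E) + t • e) = ∫⁻ x, g x := by
  have h1 := ((ℝ ∙ e).measurePreserving_measurableEquivProd (0 : E)).symm
  rw [InnerProductSpace.euclideanHausdorffMeasure_eq_volume] at h1
  have h2 : MeasurePreserving (LinearIsometryEquiv.toSpanUnitSingleton (𝕜 := ℝ) e he) :=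
    (LinearIsometryEquiv.toSpanUnitSingleton (𝕜 := ℝ) e he).measurePreserving
  rw [← h1.lintegral_comp_emb (MeasurableEquiv.measurableEmbedding _) g, Measure.volume_eq_prod,
    lintegral_prod_symm' (fun a => g (((ℝ ∙ e).measurableEquivProd 0).symm a))
      (hg.comp (MeasurableEquiv.measurable _))]
  refine lintegral_congr fun y => ?_
  rw [← h2.lintegral_comp_emb (LinearIsometryEquiv.toSpanUnitSingleton (𝕜 := ℝ) e he).toHomeomorph.measurableEmbedding]
  refine lintegral_congr fun t => ?_
  simp [add_comm]

/-- If the orthogonal projection along `e` is injective on `S` with Lipschitz inverse, then the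
surface measure of `S` is controlled by the Lebesgue measure on `e^⊥`. -/
theorem map_euclideanHausdorffMeasure_restrict_le {e : E} (he : e ≠ 0) {S : Set E} (K : ℝ≥0)
    (hK : ∀ p ∈ S, ∀ q ∈ S, dist p q ≤ K *
      dist ((ℝ ∙ e)ᗮ.orthogonalProjectionOnto p) ((ℝ ∙ e)ᗮ.orthogonalProjectionOnto q)) :
    ((Measure.euclideanHausdorffMeasure (Module.finrank ℝ E - 1)).restrict S).map
      ((ℝ ∙ e)ᗮ.orthogonalProjectionOnto) ≤ ((K : ℝ≥0∞) ^ (Module.finrank ℝ E - 1)) • volume := by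
  set d := Module.finrank ℝ E - 1 with hd
  set P := (ℝ ∙ e)ᗮ.orthogonalProjectionOnto
  have hrank : Module.finrank ℝ ((ℝ ∙ e)ᗮ : Submodule ℝ E) = d := by
    have := (ℝ ∙ e).finrank_add_finrank_orthogonal
    rw [finrank_span_singleton he] at this
    omega
  refine Measure.le_iff.2 fun A hA => ?_
  rw [Measure.map_apply P.continuous.measurable hA,
    Measure.restrict_apply (P.continuous.measurable hA)]
  set T := P ⁻¹' A ∩ S
  -- Applied to points with equal projections, `hK` gives injectivity; applied in general, it says
  -- that the inverse `f` is `K`-Lipschitz on the image.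
  have hinj : InjOn P T := fun p hp q hq h => by
    have := hK p hp.2 q hq.2
    rw [h, dist_self, mul_zero] at this
    exact dist_le_zero.1 this
  obtain ⟨f, hf⟩ : ∃ f : ((ℝ ∙ e)ᗮ : Submodule ℝ E) → E, LeftInvOn f P T :=
    ⟨_, hinj.leftInvOn_invFunOn⟩
  have hL : LipschitzOnWith K f (P '' T) := by
    refine LipschitzOnWith.of_dist_le_mul ?_
    rintro _ ⟨p, hp, rfl⟩ _ ⟨q, hq, rfl⟩
    rw [hf hp, hf hq]
    exact hK p hp.2 q hq.2
  have h1 := hL.hausdorffMeasure_image_le (d := (d : ℝ)) (by positivity)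
  rw [hf.image_image, ENNReal.rpow_natCast] at h1
  rw [← InnerProductSpace.euclideanHausdorffMeasure_eq_volume, hrank]
  -- Both sides carry the same normalizing constant, since `E` and `e^⊥` are measured in the same
  -- dimension `d`; the bound for unnormalized Hausdorff measure therefore carries over.
  simp only [Measure.euclideanHausdorffMeasure_def, Measure.smul_apply]
  calc _ ≤ _ := smul_le_smul_of_nonneg_left h1 (zero_le)
    _ = (K : ℝ≥0∞) ^ d * _ := by
        rw [ENNReal.smul_def, smul_eq_mul, mul_left_comm]
    _ ≤ _ := by
        rw [ENNReal.smul_def, smul_eq_mul, smul_eq_mul]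
        gcongr
        rintro _ ⟨p, hp, rfl⟩
        exact hp.1

/-- Integral form of `map_euclideanHausdorffMeasure_restrict_le`, combined with slicing. -/
theorem lintegral_restrict_le_of_forall_le {e : E} (he : ‖e‖ = 1) {S : Set E} (K : ℝ≥0)
    (hK : ∀ p ∈ S, ∀ q ∈ S, dist p q ≤ K *
      dist ((ℝ ∙ e)ᗮ.orthogonalProjectionOnto p) ((ℝ ∙ e)ᗮ.orthogonalProjectionOnto q))
    (hS : MeasurableSet S) {f g : E → ℝ≥0∞} (hg : Measurable g)
    (hfg : ∀ p ∈ S, f p ≤ ∫⁻ t : ℝ, g (p + t • e)) :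
    ∫⁻ x in S, f x ∂(Measure.euclideanHausdorffMeasure (Module.finrank ℝ E - 1)) ≤
      (K : ℝ≥0∞) ^ (Module.finrank ℝ E - 1) * ∫⁻ x, g x := by
  set P := (ℝ ∙ e)ᗮ.orthogonalProjectionOnto
  have he0 : e ≠ 0 := by rintro rfl; simp at he
  set h : ((ℝ ∙ e)ᗮ : Submodule ℝ E) → ℝ≥0∞ := fun y => ∫⁻ t : ℝ, g ((y : E) + t • e)
  have hh : Measurable h := by
    refine Measurable.lintegral_prod_right' (f := fun z : ((ℝ ∙ e)ᗮ : Submodule ℝ E) × ℝ =>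
      g ((z.1 : E) + z.2 • e)) (hg.comp ?_)
    fun_prop
  -- By translation invariance on `ℝ`, the integral along the line through `p` depends only on the
  -- projection `P p`.
  have hshift : ∀ p : E, ∫⁻ t : ℝ, g (p + t • e) = h (P p) := fun p => by
    obtain ⟨c, hc⟩ := Submodule.mem_span_singleton.1 ((ℝ ∙ e).starProjection_apply_mem p)
    have hp : p = (P p : E) + c • e := by
      rw [hc, Submodule.coe_orthogonalProjectionOnto_apply, add_comm]
      exact ((ℝ ∙ e).starProjection_add_starProjection_orthogonal p).symm
    calc ∫⁻ t : ℝ, g (p + t • e) = ∫⁻ t : ℝ, g ((P p : E) + (t + c) • e) := by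
          refine lintegral_congr fun t => ?_
          congr 1
          conv_lhs => rw [hp]
          rw [add_smul]; abel
      _ = _ := lintegral_add_right_eq_self (fun t : ℝ => g ((P p : E) + t • e)) c
  calc _ ≤ ∫⁻ x in S, h (P x) ∂(Measure.euclideanHausdorffMeasure (Module.finrank ℝ E - 1)) :=
        setLIntegral_mono' hS fun p hp => (hfg p hp).trans_eq (hshift p)
    _ = ∫⁻ y, h y ∂(((Measure.euclideanHausdorffMeasure (Module.finrank ℝ E - 1)).restrict S).map
          P) := (lintegral_map hh P.continuous.measurable).symm
    _ ≤ ∫⁻ y, h y ∂(((K : ℝ≥0∞) ^ (Module.finrank ℝ E - 1)) • volume) :=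
        lintegral_mono' (map_euclideanHausdorffMeasure_restrict_le he0 K hK) le_rfl
    _ = _ := by rw [lintegral_smul_measure, lintegral_lintegral_add_smul_unit he hg]; rfl

/-- The projection does not increase norms, so `S` lies over a ball of `e^⊥`, whose volume is
finite. -/
theorem euclideanHausdorffMeasure_lt_top_of_isBounded {e : E} (he : e ≠ 0) {S : Set E} (K : ℝ≥0)
    (hK : ∀ p ∈ S, ∀ q ∈ S, dist p q ≤ K *
      dist ((ℝ ∙ e)ᗮ.orthogonalProjectionOnto p) ((ℝ ∙ e)ᗮ.orthogonalProjectionOnto q))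
    (hS : Bornology.IsBounded S) :
    Measure.euclideanHausdorffMeasure (Module.finrank ℝ E - 1) S < ⊤ := by
  obtain ⟨R, hR⟩ := hS.subset_closedBall 0
  set P := (ℝ ∙ e)ᗮ.orthogonalProjectionOnto
  have h := map_euclideanHausdorffMeasure_restrict_le he K hK (Metric.closedBall 0 R)
  rw [Measure.map_apply P.continuous.measurable Metric.isClosed_closedBall.measurableSet,
    Measure.restrict_apply (P.continuous.measurable Metric.isClosed_closedBall.measurableSet),
    inter_eq_self_of_subset_right] at h
  · refine h.trans_lt ?_
    exact ENNReal.mul_lt_top (ENNReal.pow_lt_top ENNReal.coe_lt_top) measure_closedBall_lt_top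
  · intro p hp
    have := (hR hp)
    simp only [mem_preimage, mem_closedBall_zero_iff] at this ⊢
    exact ((ℝ ∙ e)ᗮ.norm_orthogonalProjectionOnto_apply_le p).trans this

end GraphMeasure

/-! ### Local geometry of the free boundary. -/

namespace OnePhase

section LocalGeometry

variable {n : ℕ} {u : EuclideanSpace ℝ (Fin n) → ℝ}

theorem IsGlobalClassicalSolution.isOpen_posPhase (hu : IsGlobalClassicalSolution u) :
    IsOpen (posPhase u) := isOpen_lt continuous_const hu.continuous

theorem isClosed_freeBdry : IsClosed (freeBdry u) := isClosed_frontier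

theorem freeBdry_subset_closure : freeBdry u ⊆ closure (posPhase u) := frontier_subset_closure

/-- Strict differentiability of the defining function at `p₀`, with `a = |∇w(p₀)|` and tolerance `a
/ 2`. Half of the slope survives, which suffices both for the graph property and for an interior
cone. -/
theorem exists_strict_linear_approx (hu : IsGlobalClassicalSolution u)
    {p₀ : EuclideanSpace ℝ (Fin n)} (hp₀ : p₀ ∈ freeBdry u) :
    ∃ (w : EuclideanSpace ℝ (Fin n) → ℝ) (e : EuclideanSpace ℝ (Fin n)) (a r : ℝ), ‖e‖ = 1 ∧
      0 < a ∧ 0 < r ∧ (∀ x ∈ Metric.ball p₀ r, (0 < u x ↔ 0 < w x)) ∧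
      (∀ x ∈ Metric.ball p₀ r ∩ freeBdry u, w x = 0) ∧
      ∀ x ∈ Metric.ball p₀ r, ∀ y ∈ Metric.ball p₀ r,
        |w x - w y - a * ⟪e, x - y⟫| ≤ a / 2 * ‖x - y‖ := by
  obtain ⟨w, U, hU, hpU, hw, hgrad, hpos⟩ := hu.smooth_freeBdry p₀ hp₀
  have hwat : ContDiffAt ℝ ∞ w p₀ := hw.contDiffAt (hU.mem_nhds hpU)
  have hstrict : HasStrictFDerivAt w (fderiv ℝ w p₀) p₀ := hwat.hasStrictFDerivAt (by simp)
  set a := ‖∇ w p₀‖ with ha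
  have ha0 : 0 < a := norm_pos_iff.2 (hgrad _ hpU)
  set e := a⁻¹ • ∇ w p₀ with he
  have hlin : ∀ v, fderiv ℝ w p₀ v = a * ⟪e, v⟫ := fun v => by
    rw [he, real_inner_smul_left, ← mul_assoc, mul_inv_cancel₀ ha0.ne', one_mul]
    exact (inner_gradient_left (𝕜 := ℝ) (f := w)).symm
  have hlo := hstrict.isLittleO.def (show (0 : ℝ) < a / 2 by positivity)
  rw [nhds_prod_eq] at hlo
  obtain ⟨t, ht, htt⟩ := eventually_prod_self_iff'.1 hlo
  obtain ⟨r, hr, hball⟩ := Metric.nhds_basis_ball.mem_iff.1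
    (inter_mem (ht) (hU.mem_nhds hpU))
  refine ⟨w, e, a, r, ?_, ha0, hr, fun x hx => hpos x (hball hx).2, ?_, ?_⟩
  · rw [he, norm_smul, norm_inv, norm_norm, ← ha, inv_mul_cancel₀ ha0.ne']
  · rintro x ⟨hx, hxF⟩
    have hxU := (hball hx).2
    refine le_antisymm ?_ ?_
    · have : x ∉ posPhase u := by
        rw [freeBdry, hu.isOpen_posPhase.frontier_eq] at hxF
        exact hxF.2
      exact not_lt.1 fun h => this ((hpos x hxU).2 h)
    -- Continuity of `w` is available only in `U`, so `x` is approached from within `posPhase u ∩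
    -- U`, where `w > 0`.
    · have hcl : x ∈ closure (posPhase u ∩ U) := by
        have := hU.inter_closure (t := posPhase u) ⟨hxU, freeBdry_subset_closure hxF⟩
        rwa [inter_comm] at this
      have := mem_closure_iff_nhdsWithin_neBot.1 hcl
      refine ge_of_tendsto (((hw.continuousOn.continuousAt (hU.mem_nhds hxU)).tendsto).mono_left
        (nhdsWithin_le_nhds (s := posPhase u ∩ U))) ?_
      filter_upwards [self_mem_nhdsWithin] with y hy
      exact ((hpos y hy.2).1 hy.1).le
  · intro x hx y hy
    have := htt x (hball hx).1 y (hball hy).1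
    simpa [hlin, ← inner_sub_right] using this

/-- Near a point of the free boundary there is a direction `e` such that the free boundary is a
Lipschitz graph over `e^⊥` and the segments in direction `e` enter the positive phase. -/
theorem exists_transversal_direction (hu : IsGlobalClassicalSolution u)
    {p₀ : EuclideanSpace ℝ (Fin n)} (hp₀ : p₀ ∈ freeBdry u) :
    ∃ (e : EuclideanSpace ℝ (Fin n)) (r : ℝ), ‖e‖ = 1 ∧ 0 < r ∧
      (∀ p ∈ freeBdry u ∩ Metric.ball p₀ r, ∀ q ∈ freeBdry u ∩ Metric.ball p₀ r,
        dist p q ≤ (2 : ℝ≥0) * dist ((ℝ ∙ e)ᗮ.orthogonalProjectionOnto p)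
          ((ℝ ∙ e)ᗮ.orthogonalProjectionOnto q)) ∧
      ∀ p ∈ freeBdry u ∩ Metric.ball p₀ r, ∀ s ∈ Ioc 0 r, p + s • e ∈ posPhase u := by
  obtain ⟨w, e, a, r, he, ha, hr, hpos, hzero, hlin⟩ := exists_strict_linear_approx hu hp₀
  have hsub : Metric.ball p₀ (r / 2) ⊆ Metric.ball p₀ r := Metric.ball_subset_ball (by linarith)
  -- A point within `r / 4` of `p₀`, moved by at most `r / 4`, stays in the ball of radius `r` where
  -- the linear approximation holds.
  refine ⟨e, r / 2 / 2, he, by positivity, ?_, ?_⟩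
  · rintro p ⟨hpF, hp⟩ q ⟨hqF, hq⟩
    replace hp := hsub (Metric.ball_subset_ball (by linarith) hp)
    replace hq := hsub (Metric.ball_subset_ball (by linarith) hq)
    have h := hlin p hp q hq
    rw [hzero p ⟨hp, hpF⟩, hzero q ⟨hq, hqF⟩, sub_zero, zero_sub, abs_neg, abs_mul,
      abs_of_pos ha] at h
    -- Since `w` vanishes at both points, only the error term is left. Pythagoras then gives `|p -
    -- q|² ≤ (4/3) |Pp - Pq|²`, so the constant `2` has room to spare.
    have h1 : |⟪e, p - q⟫| ≤ 1 / 2 * ‖p - q‖ := by nlinarith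
    rw [dist_eq_norm, dist_eq_norm, ← map_sub]
    have hpyth := (ℝ ∙ e).norm_sq_eq_add_norm_sq_projection (p - q)
    have h2 : ‖(ℝ ∙ e).orthogonalProjectionOnto (p - q)‖ = |⟪e, p - q⟫| := by
      change ‖((ℝ ∙ e).orthogonalProjectionOnto (p - q) : EuclideanSpace ℝ (Fin n))‖ = _
      rw [Submodule.coe_orthogonalProjectionOnto_apply,
        Submodule.starProjection_unit_singleton ℝ he, norm_smul, he, mul_one, Real.norm_eq_abs]
    rw [h2] at hpyth
    have h3 : |⟪e, p - q⟫| ^ 2 ≤ (1 / 2 * ‖p - q‖) ^ 2 := by gcongr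
    refine le_of_sq_le_sq ?_ (by positivity)
    push_cast
    nlinarith
  · rintro p ⟨hpF, hp⟩ s ⟨hs0, hs⟩
    have hp2 := hsub (Metric.ball_subset_ball (by linarith) hp)
    have hps : p + s • e ∈ Metric.ball p₀ r := by
      rw [Metric.mem_ball, dist_eq_norm] at hp ⊢
      have : ‖p + s • e - p₀‖ ≤ ‖p - p₀‖ + ‖s • e‖ := by
        rw [add_sub_right_comm]; exact norm_add_le _ _
      rw [norm_smul, he, mul_one, Real.norm_of_nonneg hs0.le] at this
      linarith
    refine (hpos _ hps).2 ?_
    have h := hlin _ hps p hp2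
    rw [hzero p ⟨hp2, hpF⟩, sub_zero, add_sub_cancel_left, real_inner_smul_right,
      real_inner_self_eq_norm_sq, he, norm_smul, he, Real.norm_of_nonneg hs0.le] at h
    have := (abs_le.1 h).1
    nlinarith [mul_pos ha hs0]

/-- At a boundary point `Ω` contains a truncated open convex cone with vertex `p₀`, namely the
nearby points with `⟪e, x - p₀⟫ > |x - p₀| / 2`. Uniqueness of derivatives makes one-sided
derivatives of smooth functions continuous up to `F(u)`. -/
theorem uniqueDiffOn_closure_posPhase (hu : IsGlobalClassicalSolution u) :
    UniqueDiffOn ℝ (closure (posPhase u)) := by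
  intro p₀ hp
  by_cases hpΩ : p₀ ∈ posPhase u
  · exact (hu.isOpen_posPhase.uniqueDiffWithinAt hpΩ).mono subset_closure
  have hpF : p₀ ∈ freeBdry u := by
    rw [freeBdry, hu.isOpen_posPhase.frontier_eq]; exact ⟨hp, hpΩ⟩
  obtain ⟨w, e, a, r, he, ha, hr, hpos, hzero, hlin⟩ := exists_strict_linear_approx hu hpF
  have hp₀r : p₀ ∈ Metric.ball p₀ r := Metric.mem_ball_self hr
  set C : Set (EuclideanSpace ℝ (Fin n)) :=
    Metric.ball p₀ r ∩ {x | ‖x - p₀‖ - 2 * ⟪e, x - p₀⟫ < 0} with hC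
  have hCsub : C ⊆ posPhase u := by
    rintro x ⟨hx, hx2⟩
    refine (hpos x hx).2 ?_
    have h := (abs_le.1 (hlin x hx p₀ hp₀r)).1
    rw [hzero p₀ ⟨hp₀r, hpF⟩] at h
    simp only [mem_ofPred_eq] at hx2
    nlinarith
  have hCopen : IsOpen C := Metric.isOpen_ball.inter (isOpen_lt (by fun_prop) continuous_const)
  have hconv : Convex ℝ C := by
    refine (convex_ball _ _).inter ?_
    have hf : ConvexOn ℝ univ fun x : EuclideanSpace ℝ (Fin n) =>
        ‖x - p₀‖ - 2 * ⟪e, x - p₀⟫ := by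
      refine ⟨convex_univ, fun x _ y _ s t hs ht hst => ?_⟩
      have h1 : s • x + t • y - p₀ = s • (x - p₀) + t • (y - p₀) := by
        rw [smul_sub, smul_sub, sub_add_sub_comm, ← add_smul, hst, one_smul]
      beta_reduce
      rw [h1, inner_add_right, real_inner_smul_right, real_inner_smul_right]
      have h2 := norm_add_le (s • (x - p₀)) (t • (y - p₀))
      rw [norm_smul, norm_smul, Real.norm_of_nonneg hs, Real.norm_of_nonneg ht] at h2
      simp only [smul_eq_mul]
      linarith
    simpa using hf.convex_lt 0
  have hmem : ∀ s ∈ Ioo 0 r, p₀ + s • e ∈ C := by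
    rintro s ⟨hs0, hs⟩
    refine ⟨?_, ?_⟩
    · simp [norm_smul, he, abs_of_pos hs0, hs]
    · simp only [mem_ofPred_eq, add_sub_cancel_left, real_inner_smul_right,
        real_inner_self_eq_norm_sq, norm_smul, he, Real.norm_of_nonneg hs0.le]
      linarith
  refine (uniqueDiffWithinAt_convex hconv ?_ ?_).mono (hCsub.trans subset_closure)
  · rw [hCopen.interior_eq]
    exact ⟨_, hmem (r / 2) ⟨by positivity, by linarith⟩⟩
  · have ht : Tendsto (fun s : ℝ => p₀ + s • e) (𝓝[>] 0) (𝓝 p₀) := by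
      have : Continuous fun s : ℝ => p₀ + s • e := by fun_prop
      simpa using (this.tendsto 0).mono_left (nhdsWithin_le_nhds (s := Ioi 0))
    refine mem_closure_of_tendsto ht ?_
    filter_upwards [Ioo_mem_nhdsGT hr] with s hs using hmem s hs

/-- `H` is a polynomial in first and second derivatives of `u`, which are continuous up to the
boundary. What is needed later is its boundedness on compact parts of `F(u)`. -/
theorem continuousOn_meanCurvature (hu : IsGlobalClassicalSolution u) :
    ContinuousOn (meanCurvature u) (closure (posPhase u)) := by
  have hU := uniqueDiffOn_closure_posPhase hu
  have h1 : ContDiffOn ℝ ∞ (fderivWithin ℝ u (closure (posPhase u))) (closure (posPhase u)) :=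
    hu.smooth_up_to_bdry.fderivWithin hU (by simp)
  have h2 : ContDiffOn ℝ ∞ (outerNormal u) (closure (posPhase u)) := by
    refine ContDiffOn.neg ?_
    exact (InnerProductSpace.toDual ℝ (EuclideanSpace ℝ (Fin n))).symm.contDiff.comp_contDiffOn h1
  have h3 : ContinuousOn (fderivWithin ℝ (outerNormal u) (closure (posPhase u)))
      (closure (posPhase u)) := h2.continuousOn_fderivWithin hU (by simp)
  have htr : Continuous fun A : EuclideanSpace ℝ (Fin n) →L[ℝ] EuclideanSpace ℝ (Fin n) =>
      LinearMap.trace ℝ (EuclideanSpace ℝ (Fin n)) A.toLinearMap :=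
    ((LinearMap.trace ℝ (EuclideanSpace ℝ (Fin n))).comp
      (ContinuousLinearMap.coeLM ℝ)).continuous_of_finiteDimensional
  refine ContinuousOn.neg (ContinuousOn.sub (htr.comp_continuousOn h3) ?_)
  exact (h3.clm_apply h2.continuousOn).inner h2.continuousOn

end LocalGeometry

end OnePhase

/-! ### Bounds and integrability of test functions. -/

theorem memLp_of_ae_bound_of_eq_zero {α F : Type*} [MeasurableSpace α] [NormedAddCommGroup F]
    {μ : Measure α} {f : α → F} (hf : AEStronglyMeasurable f μ) {K : Set α} (hK : MeasurableSet K)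
    (hμ : μ K ≠ ⊤) (C : ℝ) (hC : ∀ᵐ x ∂μ, ‖f x‖ ≤ C) (h0 : ∀ x ∉ K, f x = 0) (p : ℝ≥0∞) :
    MemLp f p μ := by
  have : K.indicator f = f := indicator_eq_self.2 fun x hx => by
    by_contra h; exact hx (h0 x h)
  rw [← this, memLp_indicator_iff_restrict hK]
  have : IsFiniteMeasure (μ.restrict K) := isFiniteMeasure_restrict.2 hμ
  exact MemLp.of_bound hf.restrict C (ae_restrict_of_ae hC)

theorem gradient_eq_zero_of_notMem_tsupport {E : Type*} [NormedAddCommGroup E]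
    [InnerProductSpace ℝ E] [CompleteSpace E] {f : E → ℝ} {x : E} (hx : x ∉ tsupport f) :
    ∇ f x = 0 := by
  have h : fderiv ℝ f x = 0 := by
    by_contra h
    exact hx (support_fderiv_subset ℝ h)
  rw [gradient, h, map_zero]

namespace OnePhase

variable {n : ℕ} {u : EuclideanSpace ℝ (Fin n) → ℝ}

section TestFunctions

variable {φ : EuclideanSpace ℝ (Fin n) → ℝ}

theorem continuousOn_of_mem_testFunctions (hφ : φ ∈ testFunctions u) :
    ContinuousOn φ (closure (posPhase u)) := hφ.1.continuousOn

theorem contDiffAt_of_mem_testFunctions (hu : IsGlobalClassicalSolution u)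
    (hφ : φ ∈ testFunctions u) {x : EuclideanSpace ℝ (Fin n)} (hx : x ∈ posPhase u) :
    ContDiffAt ℝ ∞ φ x :=
  (hφ.1.mono subset_closure).contDiffAt (hu.isOpen_posPhase.mem_nhds hx)

theorem differentiableAt_of_mem_testFunctions (hu : IsGlobalClassicalSolution u)
    (hφ : φ ∈ testFunctions u) {x : EuclideanSpace ℝ (Fin n)} (hx : x ∈ posPhase u) :
    DifferentiableAt ℝ φ x :=
  (contDiffAt_of_mem_testFunctions hu hφ hx).differentiableAt (by simp)

/-- A test function extended by zero may be discontinuous across `F(u)`, so `∇ φ` has no meaning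
there. The gradient within the closure is continuous up to the boundary, agrees with `∇ φ` in `Ω`,
and so yields measurability and bounds. -/
theorem continuousOn_gradientWithin (hu : IsGlobalClassicalSolution u)
    (hφ : φ ∈ testFunctions u) :
    ContinuousOn (gradientWithin φ (closure (posPhase u))) (closure (posPhase u)) :=
  (InnerProductSpace.toDual ℝ (EuclideanSpace ℝ (Fin n))).symm.continuous.comp_continuousOn
    (hφ.1.continuousOn_fderivWithin (uniqueDiffOn_closure_posPhase hu) (by simp))

theorem gradientWithin_eq_gradient (hu : IsGlobalClassicalSolution u)
    {x : EuclideanSpace ℝ (Fin n)} (hx : x ∈ posPhase u) :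
    gradientWithin φ (closure (posPhase u)) x = ∇ φ x := by
  rw [gradientWithin, gradient, fderivWithin_of_mem_nhds]
  exact mem_of_superset (hu.isOpen_posPhase.mem_nhds hx) subset_closure

theorem continuousOn_gradient (hu : IsGlobalClassicalSolution u) (hφ : φ ∈ testFunctions u) :
    ContinuousOn (∇ φ) (posPhase u) :=
  ((continuousOn_gradientWithin hu hφ).mono subset_closure).congr
    fun _ hx => (gradientWithin_eq_gradient hu hx).symm

theorem exists_bound_of_mem_testFunctions (hφ : φ ∈ testFunctions u) :
    ∃ C : ℝ, ∀ x, ‖φ x‖ ≤ C := by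
  have hK : IsCompact (tsupport φ ∩ closure (posPhase u)) := hφ.2.1.isCompact.inter_right
    isClosed_closure
  obtain ⟨C, hC⟩ := hK.exists_bound_of_continuousOn (f := φ)
    ((continuousOn_of_mem_testFunctions hφ).mono inter_subset_right)
  refine ⟨max C 0, fun x => ?_⟩
  by_cases hx : φ x = 0
  · simp [hx]
  · refine (hC x ⟨subset_tsupport _ hx, ?_⟩).trans (le_max_left _ _)
    by_contra h
    exact hx (hφ.2.2 x h)

theorem exists_gradient_bound_of_mem_testFunctions (hu : IsGlobalClassicalSolution u)
    (hφ : φ ∈ testFunctions u) : ∃ C : ℝ, ∀ x ∈ posPhase u, ‖∇ φ x‖ ≤ C := by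
  have hK : IsCompact (tsupport φ ∩ closure (posPhase u)) := hφ.2.1.isCompact.inter_right
    isClosed_closure
  obtain ⟨C, hC⟩ := hK.exists_bound_of_continuousOn
    ((continuousOn_gradientWithin hu hφ).mono inter_subset_right)
  refine ⟨max C 0, fun x hx => ?_⟩
  by_cases hxs : x ∈ tsupport φ
  · rw [← gradientWithin_eq_gradient hu hx]
    exact (hC x ⟨hxs, subset_closure hx⟩).trans (le_max_left _ _)
  · rw [gradient_eq_zero_of_notMem_tsupport hxs]
    simp

theorem aestronglyMeasurable_phase (hu : IsGlobalClassicalSolution u)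
    (hφ : φ ∈ testFunctions u) : AEStronglyMeasurable φ (phaseMeasure u) :=
  ((continuousOn_of_mem_testFunctions hφ).mono subset_closure).aestronglyMeasurable
    hu.isOpen_posPhase.measurableSet

theorem aestronglyMeasurable_gradient (hu : IsGlobalClassicalSolution u)
    (hφ : φ ∈ testFunctions u) : AEStronglyMeasurable (∇ φ) (phaseMeasure u) :=
  (continuousOn_gradient hu hφ).aestronglyMeasurable hu.isOpen_posPhase.measurableSet

theorem aestronglyMeasurable_bdry (hφ : φ ∈ testFunctions u) :
    AEStronglyMeasurable φ (bdryMeasure u) :=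
  ((continuousOn_of_mem_testFunctions hφ).mono freeBdry_subset_closure).aestronglyMeasurable
    isClosed_freeBdry.measurableSet

theorem aestronglyMeasurable_meanCurvature (hu : IsGlobalClassicalSolution u) :
    AEStronglyMeasurable (meanCurvature u) (bdryMeasure u) :=
  ((continuousOn_meanCurvature hu).mono freeBdry_subset_closure).aestronglyMeasurable
    isClosed_freeBdry.measurableSet

theorem memLp_phase (hu : IsGlobalClassicalSolution u) (hφ : φ ∈ testFunctions u) (p : ℝ≥0∞) :
    MemLp φ p (phaseMeasure u) := by
  obtain ⟨C, hC⟩ := exists_bound_of_mem_testFunctions hφ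
  refine memLp_of_ae_bound_of_eq_zero (aestronglyMeasurable_phase hu hφ)
    (isClosed_tsupport φ).measurableSet ?_ C (ae_of_all _ hC)
    (fun x hx => image_eq_zero_of_notMem_tsupport hx) p
  exact ((Measure.restrict_apply_le _ _).trans_lt hφ.2.1.isCompact.measure_lt_top).ne

theorem memLp_gradient (hu : IsGlobalClassicalSolution u) (hφ : φ ∈ testFunctions u)
    (p : ℝ≥0∞) : MemLp (∇ φ) p (phaseMeasure u) := by
  obtain ⟨C, hC⟩ := exists_gradient_bound_of_mem_testFunctions hu hφ
  refine memLp_of_ae_bound_of_eq_zero (aestronglyMeasurable_gradient hu hφ)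
    (isClosed_tsupport φ).measurableSet ?_ C ?_
    (fun x hx => gradient_eq_zero_of_notMem_tsupport hx) p
  · exact ((Measure.restrict_apply_le _ _).trans_lt hφ.2.1.isCompact.measure_lt_top).ne
  · exact (ae_restrict_iff' hu.isOpen_posPhase.measurableSet).2 (ae_of_all _ hC)

theorem mem_ball_of_hasCompactSupport (hφ : HasCompactSupport φ) :
    ∃ R : ℝ, 0 < R ∧ tsupport φ ⊆ Metric.ball 0 R := by
  obtain ⟨R, hR⟩ := hφ.isCompact.isBounded.subset_ball 0
  exact ⟨max R 1, by positivity, hR.trans (Metric.ball_subset_ball (le_max_left _ _))⟩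

end TestFunctions

/-! ### The trace inequality with a small gradient coefficient. -/

section Trace

/-- The fundamental theorem of calculus for `(1 - s/δ) ψ(p + s e)²`, which equals `ψ(p)²` at `s = 0`
and vanishes at `s = δ`, followed by `2 |ψ| |∇ψ| ≤ ψ²/ε + ε |∇ψ|²`. The indicator allows integration
over the whole line, as slicing requires. -/
theorem setLIntegral_sq_le_lintegral_line (hu : IsGlobalClassicalSolution u)
    {e p : EuclideanSpace ℝ (Fin n)} {δ : ℝ} (hδ : 0 < δ) (he : ‖e‖ = 1)
    (hp : p ∈ closure (posPhase u))
    (hline : ∀ s ∈ Ioc 0 δ, p + s • e ∈ posPhase u) {ψ : EuclideanSpace ℝ (Fin n) → ℝ}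
    (hψ : ψ ∈ testFunctions u) {ε : ℝ} (hε : 0 < ε) :
    ENNReal.ofReal (ψ p ^ 2) ≤ ∫⁻ t : ℝ, (posPhase u).indicator
      (fun x => ENNReal.ofReal ((1 / δ + 1 / ε) * ψ x ^ 2 + ε * ‖∇ ψ x‖ ^ 2)) (p + t • e) := by
  set f : ℝ → ℝ := fun s => (1 - s / δ) * ψ (p + s • e) ^ 2
  set f' : ℝ → ℝ := fun s => -(1 / δ) * ψ (p + s • e) ^ 2 +
    (1 - s / δ) * (2 * ψ (p + s • e) * ⟪∇ ψ (p + s • e), e⟫)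
  have hγ : Continuous fun s : ℝ => p + s • e := by fun_prop
  have hmaps : MapsTo (fun s : ℝ => p + s • e) (Icc 0 δ) (closure (posPhase u)) := by
    intro s hs
    rcases hs.1.eq_or_lt with h | h
    · simpa [← h] using hp
    · exact subset_closure (hline s ⟨h, hs.2⟩)
  have hmaps' : MapsTo (fun s : ℝ => p + s • e) (Ioc 0 δ) (posPhase u) := hline
  have hψc : ContinuousOn (fun s : ℝ => ψ (p + s • e)) (Icc 0 δ) :=
    (continuousOn_of_mem_testFunctions hψ).comp hγ.continuousOn hmaps
  have hgc : ContinuousOn (fun s : ℝ => ∇ ψ (p + s • e)) (Ioc 0 δ) :=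
    (continuousOn_gradient hu hψ).comp hγ.continuousOn hmaps'
  have hfc : ContinuousOn f (Icc 0 δ) := by
    refine ContinuousOn.mul (by fun_prop) (hψc.pow 2)
  have hf'c : ContinuousOn f' (Ioc 0 δ) := by
    have h1 := hψc.mono Ioc_subset_Icc_self
    have h2 : ContinuousOn (fun s : ℝ => ⟪∇ ψ (p + s • e), e⟫) (Ioc 0 δ) :=
      hgc.inner continuousOn_const
    exact (continuousOn_const.mul (h1.pow 2)).add
      (ContinuousOn.mul (by fun_prop) ((continuousOn_const.mul h1).mul h2))
  have hderiv : ∀ s ∈ Ioo 0 δ, HasDerivAt f (f' s) s := by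
    intro s hs
    have h1 : HasDerivAt (fun s : ℝ => p + s • e) e s := by
      simpa using ((hasDerivAt_id s).smul_const e).const_add p
    have h2 := ((differentiableAt_of_mem_testFunctions hu hψ
      (hline s ⟨hs.1, hs.2.le⟩)).hasGradientAt.hasFDerivAt).comp_hasDerivAt s h1
    have h3 : HasDerivAt (fun s : ℝ => 1 - s / δ) (-(1 / δ)) s := by
      simpa using ((hasDerivAt_id s).div_const δ).const_sub 1
    refine (h3.mul (h2.pow 2)).congr_deriv ?_
    simp [f']
  have hle : ∀ s ∈ Ioc 0 δ, ‖f' s‖ₑ ≤ (posPhase u).indicator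
      (fun x => ENNReal.ofReal ((1 / δ + 1 / ε) * ψ x ^ 2 + ε * ‖∇ ψ x‖ ^ 2)) (p + s • e) := by
    intro s hs
    rw [indicator_of_mem (hline s hs), ← ofReal_norm]
    refine ENNReal.ofReal_le_ofReal ?_
    set a := ψ (p + s • e)
    set v := ∇ ψ (p + s • e)
    have h1 : |⟪v, e⟫| ≤ ‖v‖ := by simpa [he] using abs_real_inner_le_norm v e
    have h2 : |1 - s / δ| ≤ 1 := by
      have : s / δ ≤ 1 := (div_le_one hδ).2 hs.2
      have : 0 < s / δ := div_pos hs.1 hδ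
      rw [abs_le]; constructor <;> linarith
    have h3 : 2 * |a| * ‖v‖ ≤ 1 / ε * a ^ 2 + ε * ‖v‖ ^ 2 := by
      have h := sq_nonneg (|a| - ε * ‖v‖)
      have h4 : ε * (2 * |a| * ‖v‖) ≤ ε * (1 / ε * a ^ 2 + ε * ‖v‖ ^ 2) := by
        rw [← sq_abs a]
        have : ε * (1 / ε * |a| ^ 2 + ε * ‖v‖ ^ 2) = |a| ^ 2 + ε ^ 2 * ‖v‖ ^ 2 := by
          field_simp
        rw [this]; nlinarith
      exact le_of_mul_le_mul_left h4 hε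
    calc ‖f' s‖ ≤ ‖-(1 / δ) * a ^ 2‖ + ‖(1 - s / δ) * (2 * a * ⟪v, e⟫)‖ := norm_add_le _ _
      _ ≤ 1 / δ * a ^ 2 + 1 * (2 * |a| * ‖v‖) := by
          simp only [norm_mul, norm_neg, Real.norm_eq_abs, abs_pow, sq_abs, abs_two]
          rw [abs_of_pos (by positivity : 0 < 1 / δ)]
          gcongr
      _ ≤ _ := by linarith
  -- `f'` is known to be continuous only away from `s = 0`, where the line meets the boundary;
  -- integrability comes from the uniform bounds on `ψ` and `∇ ψ`.
  have hint : IntervalIntegrable f' volume 0 δ := by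
    rw [intervalIntegrable_iff_integrableOn_Ioc_of_le hδ.le]
    obtain ⟨C, hC⟩ := exists_bound_of_mem_testFunctions hψ
    obtain ⟨C', hC'⟩ := exists_gradient_bound_of_mem_testFunctions hu hψ
    have hC0 : 0 ≤ C := (norm_nonneg _).trans (hC 0)
    refine IntegrableOn.of_bound measure_Ioc_lt_top
      (hf'c.aestronglyMeasurable measurableSet_Ioc) ((1 / δ + 1 / ε) * C ^ 2 + ε * C' ^ 2) ?_
    refine (ae_restrict_iff' measurableSet_Ioc).2 (ae_of_all _ fun s hs => ?_)
    have h := hle s hs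
    rw [indicator_of_mem (hline s hs), ← ofReal_norm,
      ENNReal.ofReal_le_ofReal_iff (by positivity)] at h
    refine h.trans ?_
    have h1 := hC' _ (hline s hs)
    have h2 := hC (p + s • e)
    rw [← sq_abs (ψ _), ← Real.norm_eq_abs]
    gcongr
  have hFTC := intervalIntegral.integral_eq_sub_of_hasDerivAt_of_le hδ.le hfc hderiv hint
  have h0 : ψ p ^ 2 = -∫ s in (0 : ℝ)..δ, f' s := by
    rw [hFTC]; simp [f, hδ.ne']
  calc ENNReal.ofReal (ψ p ^ 2) = ‖∫ s in Ioc 0 δ, f' s‖ₑ := by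
        rw [← intervalIntegral.integral_of_le hδ.le, ← ofReal_norm, ← norm_neg, ← h0,
          Real.norm_of_nonneg (sq_nonneg _)]
    _ ≤ ∫⁻ s in Ioc 0 δ, ‖f' s‖ₑ := enorm_integral_le_lintegral_enorm _
    _ ≤ ∫⁻ s in Ioc 0 δ, (posPhase u).indicator (fun x =>
        ENNReal.ofReal ((1 / δ + 1 / ε) * ψ x ^ 2 + ε * ‖∇ ψ x‖ ^ 2)) (p + s • e) :=
        setLIntegral_mono' measurableSet_Ioc hle
    _ ≤ _ := setLIntegral_le_lintegral _ _

/-- The local trace inequality near a point of the free boundary. -/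
theorem exists_ball_trace_inequality (hu : IsGlobalClassicalSolution u)
    {p₀ : EuclideanSpace ℝ (Fin n)} (hp₀ : p₀ ∈ freeBdry u) :
    ∃ r : ℝ, 0 < r ∧ bdryMeasure u (Metric.ball p₀ r) < ⊤ ∧
      ∀ ε : ℝ, 0 < ε → ∃ C : ℝ, 0 ≤ C ∧ ∀ ψ ∈ testFunctions u,
        ∫⁻ x in Metric.ball p₀ r, ENNReal.ofReal (ψ x ^ 2) ∂(bdryMeasure u) ≤
          ENNReal.ofReal (ε * (∫ x, ‖∇ ψ x‖ ^ 2 ∂(phaseMeasure u)) +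
            C * ∫ x, ψ x ^ 2 ∂(phaseMeasure u)) := by
  obtain ⟨e, r, he, hr, hlip, hline⟩ := exists_transversal_direction hu hp₀
  have he0 : e ≠ 0 := by rintro rfl; simp at he
  have hmeas : MeasurableSet (freeBdry u ∩ Metric.ball p₀ r) :=
    isClosed_freeBdry.measurableSet.inter measurableSet_ball
  have hrestr : (bdryMeasure u).restrict (Metric.ball p₀ r) =
      (Measure.euclideanHausdorffMeasure (n - 1)).restrict (freeBdry u ∩ Metric.ball p₀ r) := by
    rw [bdryMeasure, Measure.restrict_restrict measurableSet_ball, inter_comm]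
  refine ⟨r, hr, ?_, fun ε hε => ?_⟩
  · have h := euclideanHausdorffMeasure_lt_top_of_isBounded he0 2 hlip
      (Metric.isBounded_ball.subset inter_subset_right)
    rw [finrank_euclideanSpace_fin] at h
    rwa [bdryMeasure, Measure.restrict_apply measurableSet_ball, inter_comm]
  -- This compensates the factor `2 ^ (n - 1)` from the Lipschitz constant `2`. The radius `r` was
  -- fixed before `ε`, so one finite cover serves every `ε`.
  · set ε' := ε / 2 ^ (n - 1)
    have hε' : 0 < ε' := by positivity
    refine ⟨2 ^ (n - 1) * (1 / r + 1 / ε'), by positivity, fun ψ hψ => ?_⟩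
    set g : EuclideanSpace ℝ (Fin n) → ℝ≥0∞ := (posPhase u).indicator
      fun x => ENNReal.ofReal ((1 / r + 1 / ε') * ψ x ^ 2 + ε' * ‖∇ ψ x‖ ^ 2)
    have hψm := (continuousOn_of_mem_testFunctions hψ).mono
      (subset_closure (s := posPhase u))
    have hg : Measurable g := by
      classical
      have hc : ContinuousOn (fun x => ENNReal.ofReal
          ((1 / r + 1 / ε') * ψ x ^ 2 + ε' * ‖∇ ψ x‖ ^ 2)) (posPhase u) :=
        ENNReal.continuous_ofReal.comp_continuousOn
          ((continuousOn_const.mul (hψm.pow 2)).add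
            (continuousOn_const.mul ((continuousOn_gradient hu hψ).norm.pow 2)))
      have := hc.measurable_piecewise (g := 0) continuous_zero.continuousOn
        hu.isOpen_posPhase.measurableSet
      rwa [piecewise_eq_indicator] at this
    have h := lintegral_restrict_le_of_forall_le he 2 hlip hmeas hg
      (f := fun x => ENNReal.ofReal (ψ x ^ 2)) fun p hp =>
        setLIntegral_sq_le_lintegral_line hu hr he (freeBdry_subset_closure hp.1)
          (hline p hp) hψ hε'
    rw [finrank_euclideanSpace_fin] at h
    rw [hrestr]
    refine h.trans_eq ?_
    have hi1 : Integrable (fun x => ψ x ^ 2) (phaseMeasure u) := (memLp_phase hu hψ 2).integrable_sq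
    have hi2 : Integrable (fun x => ‖∇ ψ x‖ ^ 2) (phaseMeasure u) :=
      (memLp_gradient hu hψ 2).integrable_norm_pow (by norm_num)
    have hconv := ofReal_integral_eq_lintegral_ofReal
      (f := fun x => (1 / r + 1 / ε') * ψ x ^ 2 + ε' * ‖∇ ψ x‖ ^ 2)
      ((hi1.const_mul _).add (hi2.const_mul _))
      (ae_of_all _ fun x => by simp only [Pi.zero_apply]; positivity)
    rw [lintegral_indicator hu.isOpen_posPhase.measurableSet, ← phaseMeasure, ← hconv,
      integral_add (hi1.const_mul _) (hi2.const_mul _), integral_const_mul, integral_const_mul]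
    have h2 : ((2 : ℝ≥0) : ℝ≥0∞) ^ (n - 1) = ENNReal.ofReal (2 ^ (n - 1)) := by
      rw [ENNReal.ofReal_pow (by norm_num)]; simp
    rw [h2, ← ENNReal.ofReal_mul (by positivity)]
    congr 1
    simp only [ε']
    field_simp
    ring

/-- The trace inequality on bounded parts of the free boundary. -/
theorem exists_trace_inequality (hu : IsGlobalClassicalSolution u) (R : ℝ) :
    bdryMeasure u (Metric.closedBall 0 R) < ⊤ ∧
      ∀ ε : ℝ, 0 < ε → ∃ C : ℝ, 0 ≤ C ∧ ∀ ψ ∈ testFunctions u,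
        ∫⁻ x in Metric.closedBall 0 R, ENNReal.ofReal (ψ x ^ 2) ∂(bdryMeasure u) ≤
          ENNReal.ofReal (ε * (∫ x, ‖∇ ψ x‖ ^ 2 ∂(phaseMeasure u)) +
            C * ∫ x, ψ x ^ 2 ∂(phaseMeasure u)) := by
  have hK : IsCompact (freeBdry u ∩ Metric.closedBall 0 R) :=
    (isCompact_closedBall 0 R).inter_left isClosed_freeBdry
  have key : bdryMeasure u (freeBdry u ∩ Metric.closedBall 0 R) < ⊤ ∧
      ∀ ε : ℝ, 0 < ε → ∃ C : ℝ, 0 ≤ C ∧ ∀ ψ ∈ testFunctions u,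
        ∫⁻ x in freeBdry u ∩ Metric.closedBall 0 R,
          ENNReal.ofReal (ψ x ^ 2) ∂(bdryMeasure u) ≤
          ENNReal.ofReal (ε * (∫ x, ‖∇ ψ x‖ ^ 2 ∂(phaseMeasure u)) +
            C * ∫ x, ψ x ^ 2 ∂(phaseMeasure u)) := by
    refine hK.induction_on (p := fun S => bdryMeasure u S < ⊤ ∧
      ∀ ε : ℝ, 0 < ε → ∃ C : ℝ, 0 ≤ C ∧ ∀ ψ ∈ testFunctions u,
        ∫⁻ x in S, ENNReal.ofReal (ψ x ^ 2) ∂(bdryMeasure u) ≤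
          ENNReal.ofReal (ε * (∫ x, ‖∇ ψ x‖ ^ 2 ∂(phaseMeasure u)) +
            C * ∫ x, ψ x ^ 2 ∂(phaseMeasure u))) ?_ ?_ ?_ ?_
    · exact ⟨by simp, fun ε _ => ⟨0, le_rfl, fun ψ _ => by simp⟩⟩
    · rintro S T hST ⟨h1, h2⟩
      refine ⟨(measure_mono hST).trans_lt h1, fun ε hε => ?_⟩
      obtain ⟨C, hC, h⟩ := h2 ε hε
      exact ⟨C, hC, fun ψ hψ => (lintegral_mono_set hST).trans (h ψ hψ)⟩
    · rintro S T ⟨hS1, hS2⟩ ⟨hT1, hT2⟩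
      refine ⟨measure_union_lt_top hS1 hT1, fun ε hε => ?_⟩
      -- Having the inequality for every `ε` is what makes it stable under unions: each piece is
      -- used with half of `ε`.
      obtain ⟨C, hC, h⟩ := hS2 (ε / 2) (by positivity)
      obtain ⟨C', hC', h'⟩ := hT2 (ε / 2) (by positivity)
      refine ⟨C + C', by positivity, fun ψ hψ => ?_⟩
      have h1 : 0 ≤ ∫ x, ‖∇ ψ x‖ ^ 2 ∂(phaseMeasure u) := integral_nonneg fun _ => by positivity
      have h2 : 0 ≤ ∫ x, ψ x ^ 2 ∂(phaseMeasure u) := integral_nonneg fun _ => by positivity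
      refine (lintegral_union_le _ _ _).trans ((add_le_add (h ψ hψ) (h' ψ hψ)).trans_eq ?_)
      rw [← ENNReal.ofReal_add (by positivity) (by positivity)]
      congr 1; ring
    · rintro p ⟨hp, -⟩
      obtain ⟨r, hr, h1, h2⟩ := exists_ball_trace_inequality hu hp
      exact ⟨_, mem_nhdsWithin_of_mem_nhds (Metric.ball_mem_nhds p hr), h1, h2⟩
  have hrestr : (bdryMeasure u).restrict (Metric.closedBall 0 R) =
      (bdryMeasure u).restrict (freeBdry u ∩ Metric.closedBall 0 R) := by
    rw [bdryMeasure, Measure.restrict_restrict measurableSet_closedBall, Measure.restrict_restrict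
      (isClosed_freeBdry.measurableSet.inter measurableSet_closedBall)]
    congr 1
    ext x
    simp only [mem_inter_iff]
    tauto
  rw [hrestr, ← Measure.restrict_apply_univ (μ := bdryMeasure u) (Metric.closedBall 0 R), hrestr,
    Measure.restrict_apply_univ]
  exact key

end Trace

end OnePhase

/-! ### Gradient calculus and `Q` as a bilinear form. -/

theorem gradient_add_of_differentiableAt {E : Type*} [NormedAddCommGroup E]
    [InnerProductSpace ℝ E] [CompleteSpace E] {f g : E → ℝ} {x : E} (hf : DifferentiableAt ℝ f x)
    (hg : DifferentiableAt ℝ g x) : ∇ (f + g) x = ∇ f x + ∇ g x := by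
  rw [gradient, fderiv_add hf hg, map_add]; rfl

theorem gradient_smul_of_differentiableAt {E : Type*} [NormedAddCommGroup E]
    [InnerProductSpace ℝ E] [CompleteSpace E] {f : E → ℝ} {x : E} (hf : DifferentiableAt ℝ f x)
    (c : ℝ) : ∇ (c • f) x = c • ∇ f x := by
  rw [gradient, fderiv_const_smul hf, map_smul]; rfl

theorem gradient_mul_of_differentiableAt {E : Type*} [NormedAddCommGroup E]
    [InnerProductSpace ℝ E] [CompleteSpace E] {f g : E → ℝ} {x : E} (hf : DifferentiableAt ℝ f x)
    (hg : DifferentiableAt ℝ g x) :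
    ∇ (fun y => f y * g y) x = f x • ∇ g x + g x • ∇ f x := by
  rw [gradient, fderiv_fun_mul hf hg, map_add, map_smul, map_smul]; rfl

theorem continuous_gradient_of_contDiff {E : Type*} [NormedAddCommGroup E]
    [InnerProductSpace ℝ E] [CompleteSpace E] {f : E → ℝ} (hf : ContDiff ℝ ∞ f) :
    Continuous (∇ f) :=
  (InnerProductSpace.toDual ℝ E).symm.continuous.comp (hf.continuous_fderiv (by simp))

theorem integrable_inner_of_memLp {α E : Type*} [MeasurableSpace α] [NormedAddCommGroup E]
    [InnerProductSpace ℝ E] {μ : Measure α} {f g : α → E} (hf : MemLp f 2 μ) (hg : MemLp g 2 μ) :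
    Integrable (fun x => ⟪f x, g x⟫) μ := by
  refine (L2.integrable_inner (𝕜 := ℝ) (hf.toLp f) (hg.toLp g)).congr ?_
  filter_upwards [hf.coeFn_toLp, hg.coeFn_toLp] with x h1 h2
  rw [h1, h2]

namespace OnePhase

variable {n : ℕ} {u : EuclideanSpace ℝ (Fin n) → ℝ}

section Integrability

variable {φ ψ : EuclideanSpace ℝ (Fin n) → ℝ}

theorem bdryMeasure_lt_top_of_isCompact (hu : IsGlobalClassicalSolution u)
    {K : Set (EuclideanSpace ℝ (Fin n))} (hK : IsCompact K) : bdryMeasure u K < ⊤ := by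
  obtain ⟨R, hR⟩ := hK.isBounded.subset_closedBall 0
  exact (measure_mono hR).trans_lt (exists_trace_inequality hu R).1

theorem memLp_bdry (hu : IsGlobalClassicalSolution u) (hφ : φ ∈ testFunctions u) (p : ℝ≥0∞) :
    MemLp φ p (bdryMeasure u) := by
  obtain ⟨C, hC⟩ := exists_bound_of_mem_testFunctions hφ
  exact memLp_of_ae_bound_of_eq_zero (aestronglyMeasurable_bdry hφ)
    (isClosed_tsupport φ).measurableSet (bdryMeasure_lt_top_of_isCompact hu hφ.2.1.isCompact).ne
    C (ae_of_all _ hC) (fun x hx => image_eq_zero_of_notMem_tsupport hx) p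

theorem exists_meanCurvature_bound (hu : IsGlobalClassicalSolution u) (R : ℝ) :
    ∃ M : ℝ, 0 < M ∧ ∀ x ∈ freeBdry u ∩ Metric.closedBall 0 R, |meanCurvature u x| ≤ M := by
  obtain ⟨M, hM⟩ := ((isCompact_closedBall (0 : EuclideanSpace ℝ (Fin n)) R).inter_left
    (isClosed_freeBdry (u := u))).exists_bound_of_continuousOn
    ((continuousOn_meanCurvature hu).mono (inter_subset_left.trans freeBdry_subset_closure))
  exact ⟨max M 1, by positivity, fun x hx => (hM x hx).trans (le_max_left _ _)⟩

theorem memLp_meanCurvature_mul (hu : IsGlobalClassicalSolution u) (hφ : φ ∈ testFunctions u)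
    (p : ℝ≥0∞) : MemLp (fun x => meanCurvature u x * φ x) p (bdryMeasure u) := by
  obtain ⟨C, hC⟩ := exists_bound_of_mem_testFunctions hφ
  obtain ⟨R, hR0, hR⟩ := mem_ball_of_hasCompactSupport hφ.2.1
  obtain ⟨M, hM0, hM⟩ := exists_meanCurvature_bound hu R
  have h0 : ∀ x ∉ tsupport φ, meanCurvature u x * φ x = 0 := fun x hx => by
    rw [image_eq_zero_of_notMem_tsupport hx, mul_zero]
  refine memLp_of_ae_bound_of_eq_zero
    ((aestronglyMeasurable_meanCurvature hu).mul (aestronglyMeasurable_bdry hφ))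
    (isClosed_tsupport φ).measurableSet (bdryMeasure_lt_top_of_isCompact hu hφ.2.1.isCompact).ne
    (M * C) ((ae_restrict_iff' isClosed_freeBdry.measurableSet).2 (ae_of_all _ fun x hx => ?_))
    h0 p
  have hC0 : 0 ≤ C := (norm_nonneg _).trans (hC 0)
  by_cases hxs : x ∈ tsupport φ
  · rw [Pi.mul_apply, norm_mul]
    exact mul_le_mul (hM x ⟨hx, Metric.ball_subset_closedBall (hR hxs)⟩) (hC x) (norm_nonneg _)
      hM0.le
  · rw [Pi.mul_apply, h0 x hxs, norm_zero]; positivity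

theorem integrable_inner_gradient (hu : IsGlobalClassicalSolution u)
    (hφ : φ ∈ testFunctions u) (hψ : ψ ∈ testFunctions u) :
    Integrable (fun x => ⟪∇ φ x, ∇ ψ x⟫) (phaseMeasure u) :=
  integrable_inner_of_memLp (memLp_gradient hu hφ 2) (memLp_gradient hu hψ 2)

theorem integrable_meanCurvature_mul_mul (hu : IsGlobalClassicalSolution u)
    (hφ : φ ∈ testFunctions u) (hψ : ψ ∈ testFunctions u) :
    Integrable (fun x => meanCurvature u x * φ x * ψ x) (bdryMeasure u) :=
  (memLp_meanCurvature_mul hu hφ 2).integrable_mul (memLp_bdry hu hψ 2)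

theorem integrable_mul_phase (hu : IsGlobalClassicalSolution u)
    (hφ : φ ∈ testFunctions u) (hψ : ψ ∈ testFunctions u) :
    Integrable (fun x => φ x * ψ x) (phaseMeasure u) :=
  (memLp_phase hu hφ 2).integrable_mul (memLp_phase hu hψ 2)

theorem ae_phase_of_forall (hu : IsGlobalClassicalSolution u)
    {P : EuclideanSpace ℝ (Fin n) → Prop} (h : ∀ x ∈ posPhase u, P x) :
    ∀ᵐ x ∂(phaseMeasure u), P x :=
  (ae_restrict_iff' hu.isOpen_posPhase.measurableSet).2 (ae_of_all _ h)

theorem integral_sq_nonneg (μ : Measure (EuclideanSpace ℝ (Fin n)))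
    (φ : EuclideanSpace ℝ (Fin n) → ℝ) : 0 ≤ ∫ x, φ x ^ 2 ∂μ :=
  integral_nonneg fun _ => sq_nonneg _

end Integrability

section Bilinear

variable {φ φ' ψ : EuclideanSpace ℝ (Fin n) → ℝ}

theorem secondVariation_comm : secondVariation u φ ψ = secondVariation u ψ φ := by
  simp only [secondVariation]
  congr 1
  · exact integral_congr_ae (ae_of_all _ fun x => real_inner_comm _ _)
  · exact integral_congr_ae (ae_of_all _ fun x => by ring)

theorem secondVariation_add_left (hu : IsGlobalClassicalSolution u)
    (hφ : φ ∈ testFunctions u) (hφ' : φ' ∈ testFunctions u) (hψ : ψ ∈ testFunctions u) :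
    secondVariation u (φ + φ') ψ = secondVariation u φ ψ + secondVariation u φ' ψ := by
  simp only [secondVariation]
  have h1 : ∫ x, ⟪∇ (φ + φ') x, ∇ ψ x⟫ ∂(phaseMeasure u) =
      ∫ x, (⟪∇ φ x, ∇ ψ x⟫ + ⟪∇ φ' x, ∇ ψ x⟫) ∂(phaseMeasure u) :=
    integral_congr_ae (ae_phase_of_forall hu fun x hx => by
      simp only [gradient_add_of_differentiableAt (differentiableAt_of_mem_testFunctions hu hφ hx)
        (differentiableAt_of_mem_testFunctions hu hφ' hx), inner_add_left])
  have h2 : ∫ x, meanCurvature u x * (φ + φ') x * ψ x ∂(bdryMeasure u) =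
      ∫ x, (meanCurvature u x * φ x * ψ x + meanCurvature u x * φ' x * ψ x) ∂(bdryMeasure u) :=
    integral_congr_ae (ae_of_all _ fun x => by simp only [Pi.add_apply]; ring)
  rw [h1, h2, integral_add (integrable_inner_gradient hu hφ hψ)
    (integrable_inner_gradient hu hφ' hψ), integral_add (integrable_meanCurvature_mul_mul hu hφ hψ)
    (integrable_meanCurvature_mul_mul hu hφ' hψ)]
  ring

theorem secondVariation_smul_left (hu : IsGlobalClassicalSolution u)
    (hφ : φ ∈ testFunctions u) (c : ℝ) :
    secondVariation u (c • φ) ψ = c * secondVariation u φ ψ := by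
  simp only [secondVariation]
  have h1 : ∫ x, ⟪∇ (c • φ) x, ∇ ψ x⟫ ∂(phaseMeasure u) =
      ∫ x, c * ⟪∇ φ x, ∇ ψ x⟫ ∂(phaseMeasure u) :=
    integral_congr_ae (ae_phase_of_forall hu fun x hx => by
      simp only [gradient_smul_of_differentiableAt
        (differentiableAt_of_mem_testFunctions hu hφ hx), real_inner_smul_left])
  have h2 : ∫ x, meanCurvature u x * (c • φ) x * ψ x ∂(bdryMeasure u) =
      ∫ x, c * (meanCurvature u x * φ x * ψ x) ∂(bdryMeasure u) :=
    integral_congr_ae (ae_of_all _ fun x => by simp only [Pi.smul_apply, smul_eq_mul]; ring)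
  rw [h1, h2, integral_const_mul, integral_const_mul, mul_sub]

/-- The second variation as a bilinear form on the test functions. -/
noncomputable def secondVariationForm (hu : IsGlobalClassicalSolution u) :
    LinearMap.BilinForm ℝ (testFunctions u) :=
  LinearMap.mk₂ ℝ (fun φ ψ => secondVariation u φ ψ)
    (fun φ φ' ψ => secondVariation_add_left hu φ.2 φ'.2 ψ.2)
    (fun c φ _ => secondVariation_smul_left hu φ.2 c)
    (fun φ ψ ψ' => by
      simp only [secondVariation_comm (φ := (φ : EuclideanSpace ℝ (Fin n) → ℝ))]
      exact secondVariation_add_left hu ψ.2 ψ'.2 φ.2)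
    (fun c φ ψ => by
      simp only [secondVariation_comm (φ := (φ : EuclideanSpace ℝ (Fin n) → ℝ))]
      exact secondVariation_smul_left hu ψ.2 c)

@[simp]
theorem secondVariationForm_apply (hu : IsGlobalClassicalSolution u) (φ ψ : testFunctions u) :
    secondVariationForm hu φ ψ = secondVariation u φ ψ := rfl

end Bilinear

/-! ### Cutoff and localization identities. -/

section Cutoff

variable {φ ψ η ζ : EuclideanSpace ℝ (Fin n) → ℝ}

theorem mul_mem_testFunctions (hη : ContDiff ℝ ∞ η) (hφ : φ ∈ testFunctions u) :
    (fun x => η x * φ x) ∈ testFunctions u :=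
  ⟨hη.contDiffOn.mul hφ.1, hφ.2.1.mul_left, fun x hx => by simp [hφ.2.2 x hx]⟩

theorem gradient_cutoff_mul (hu : IsGlobalClassicalSolution u) (hη : ContDiff ℝ ∞ η)
    (hφ : φ ∈ testFunctions u) {x : EuclideanSpace ℝ (Fin n)} (hx : x ∈ posPhase u) :
    ∇ (fun y => η y * φ y) x = η x • ∇ φ x + φ x • ∇ η x :=
  gradient_mul_of_differentiableAt (hη.differentiable (by simp)).differentiableAt
    (differentiableAt_of_mem_testFunctions hu hφ hx)

theorem integrable_normSq_gradient_mul_mul (hu : IsGlobalClassicalSolution u)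
    (hη : ContDiff ℝ ∞ η) (hφ : φ ∈ testFunctions u) (hψ : ψ ∈ testFunctions u) :
    Integrable (fun x => ‖∇ η x‖ ^ 2 * (φ x * ψ x)) (phaseMeasure u) := by
  have hc := continuous_gradient_of_contDiff hη
  obtain ⟨C, hC⟩ := hφ.2.1.isCompact.exists_bound_of_continuousOn (f := fun x => ‖∇ η x‖ ^ 2)
    (by fun_prop)
  refine ((integrable_mul_phase hu hφ hψ).norm.const_mul C).mono'
    ((hc.norm.pow 2).aestronglyMeasurable.mul (integrable_mul_phase hu hφ hψ).1)
    (ae_of_all _ fun x => ?_)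
  by_cases hx : x ∈ tsupport φ
  · rw [norm_mul]
    exact mul_le_mul_of_nonneg_right (hC x hx) (norm_nonneg _)
  · simp [image_eq_zero_of_notMem_tsupport hx]

/-- The product rule gives `∇(ηφ)·∇(ηψ) = (∇φ·∇(η²ψ) + ∇ψ·∇(η²φ))/2 + |∇η|² φψ`. The error contains
no derivative of `φ` or `ψ`, so it is controlled in `L²` alone, and the main terms have the form to
which a weak equation applies. -/
theorem secondVariation_cutoff (hu : IsGlobalClassicalSolution u) (hη : ContDiff ℝ ∞ η)
    (hφ : φ ∈ testFunctions u) (hψ : ψ ∈ testFunctions u) :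
    secondVariation u (fun x => η x * φ x) (fun x => η x * ψ x) =
      (secondVariation u φ (fun x => η x ^ 2 * ψ x) +
        secondVariation u ψ (fun x => η x ^ 2 * φ x)) / 2 +
      ∫ x, ‖∇ η x‖ ^ 2 * (φ x * ψ x) ∂(phaseMeasure u) := by
  have hη2 : ContDiff ℝ ∞ fun x => η x ^ 2 := hη.pow 2
  have hφ1 := mul_mem_testFunctions hη hφ
  have hψ1 := mul_mem_testFunctions hη hψ
  have hφ2 := mul_mem_testFunctions hη2 hφ
  have hψ2 := mul_mem_testFunctions hη2 hψ
  have hgrad2 : ∀ x, ∇ (fun y => η y ^ 2) x = (2 * η x) • ∇ η x := fun x => by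
    have hd : DifferentiableAt ℝ η x := (hη.differentiable (by simp)).differentiableAt
    have := gradient_mul_of_differentiableAt hd hd
    simp only [← pow_two] at this
    rw [this, ← add_smul, two_mul]
  have h1 : ∫ x, ⟪∇ (fun x => η x * φ x) x, ∇ (fun x => η x * ψ x) x⟫ ∂(phaseMeasure u) =
      ∫ x, ((⟪∇ φ x, ∇ (fun x => η x ^ 2 * ψ x) x⟫ + ⟪∇ ψ x, ∇ (fun x => η x ^ 2 * φ x) x⟫) / 2 +
        ‖∇ η x‖ ^ 2 * (φ x * ψ x)) ∂(phaseMeasure u) := by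
    refine integral_congr_ae (ae_phase_of_forall hu fun x hx => ?_)
    simp only [gradient_cutoff_mul hu hη hφ hx, gradient_cutoff_mul hu hη hψ hx,
      gradient_cutoff_mul hu hη2 hφ hx, gradient_cutoff_mul hu hη2 hψ hx, hgrad2,
      inner_add_left, inner_add_right, real_inner_smul_left, real_inner_smul_right,
      real_inner_self_eq_norm_sq]
    rw [real_inner_comm (∇ φ x) (∇ ψ x), real_inner_comm (∇ ψ x) (∇ η x)]
    ring
  have h2 : ∫ x, meanCurvature u x * (η x * φ x) * (η x * ψ x) ∂(bdryMeasure u) =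
      ∫ x, (meanCurvature u x * φ x * (η x ^ 2 * ψ x) +
        meanCurvature u x * ψ x * (η x ^ 2 * φ x)) / 2 ∂(bdryMeasure u) :=
    integral_congr_ae (ae_of_all _ fun x => by ring)
  simp only [secondVariation]
  rw [h1, h2, integral_add, integral_div, integral_div, integral_add, integral_add]
  · ring
  · exact integrable_meanCurvature_mul_mul hu hφ hψ2
  · exact integrable_meanCurvature_mul_mul hu hψ hφ2
  · exact integrable_inner_gradient hu hφ hψ2
  · exact integrable_inner_gradient hu hψ hφ2
  · exact ((integrable_inner_gradient hu hφ hψ2).add (integrable_inner_gradient hu hψ hφ2)).div_const 2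
  · exact integrable_normSq_gradient_mul_mul hu hη hφ hψ

/-- The localization formula for a partition of unity `η² + ζ² = 1`. -/
theorem secondVariation_localization (hu : IsGlobalClassicalSolution u) (hη : ContDiff ℝ ∞ η)
    (hζ : ContDiff ℝ ∞ ζ) (h1 : ∀ x, η x ^ 2 + ζ x ^ 2 = 1) (hφ : φ ∈ testFunctions u) :
    secondVariation u (fun x => η x * φ x) (fun x => η x * φ x) +
      secondVariation u (fun x => ζ x * φ x) (fun x => ζ x * φ x) =
      secondVariation u φ φ +
        ∫ x, (‖∇ η x‖ ^ 2 + ‖∇ ζ x‖ ^ 2) * φ x ^ 2 ∂(phaseMeasure u) := by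
  have h3 : secondVariation u φ (fun x => η x ^ 2 * φ x) +
      secondVariation u φ (fun x => ζ x ^ 2 * φ x) = secondVariation u φ φ := by
    have hη2 := mul_mem_testFunctions (hη.pow 2) hφ
    have hζ2 := mul_mem_testFunctions (hζ.pow 2) hφ
    rw [secondVariation_comm, secondVariation_comm (φ := φ) (ψ := fun x => ζ x ^ 2 * φ x),
      ← secondVariation_add_left hu hη2 hζ2 hφ]
    congr 1
    ext x
    simp only [Pi.add_apply]
    rw [← add_mul, h1, one_mul]
  have h4 : ∫ x, (‖∇ η x‖ ^ 2 + ‖∇ ζ x‖ ^ 2) * φ x ^ 2 ∂(phaseMeasure u) =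
      ∫ x, ‖∇ η x‖ ^ 2 * (φ x * φ x) ∂(phaseMeasure u) +
        ∫ x, ‖∇ ζ x‖ ^ 2 * (φ x * φ x) ∂(phaseMeasure u) := by
    rw [← integral_add (integrable_normSq_gradient_mul_mul hu hη hφ hφ)
      (integrable_normSq_gradient_mul_mul hu hζ hφ hφ)]
    exact integral_congr_ae (ae_of_all _ fun x => by ring)
  rw [secondVariation_cutoff hu hη hφ hφ, secondVariation_cutoff hu hζ hφ hφ, h4, ← h3]
  ring

/-- With `η = sin θ` and `ζ = cos θ` for `θ = (π/2)` times a bump function, smoothness needs no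
square roots and `|∇η|² + |∇ζ|² = |∇θ|²`. -/
theorem exists_quadratic_partition (E : Type*) [NormedAddCommGroup E] [InnerProductSpace ℝ E]
    [FiniteDimensional ℝ E] (R : ℝ) :
    ∃ (η ζ : E → ℝ) (R' C : ℝ), ContDiff ℝ ∞ η ∧ ContDiff ℝ ∞ ζ ∧
      (∀ x, η x ^ 2 + ζ x ^ 2 = 1) ∧ (∀ x ∈ Metric.closedBall (0 : E) R, η x = 1 ∧ ζ x = 0) ∧
      (∀ x ∉ Metric.closedBall (0 : E) R', η x = 0) ∧ 0 ≤ C ∧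
      ∀ x, ‖∇ η x‖ ^ 2 + ‖∇ ζ x‖ ^ 2 ≤ C := by
  -- The inner radius of a bump function must be positive, whereas `R` is arbitrary.
  set r : ℝ := max R 1 with hr
  let f : ContDiffBump (0 : E) := ⟨r, r + 1, by positivity, by linarith⟩
  have hf : ContDiff ℝ ∞ f := f.contDiff
  set θ : E → ℝ := fun x => Real.pi / 2 * f x
  have hθ : ContDiff ℝ ∞ θ := contDiff_const.mul hf
  have hθc : HasCompactSupport (∇ θ) := by
    refine HasCompactSupport.of_support_subset_isCompact
      ((f.hasCompactSupport.mul_left (f := fun _ => Real.pi / 2)).isCompact) fun x hx => ?_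
    by_contra h
    exact hx (gradient_eq_zero_of_notMem_tsupport (f := θ) h)
  obtain ⟨C, hC⟩ := (continuous_gradient_of_contDiff hθ).bounded_above_of_compact_support hθc
  have hs : ∀ x, ∇ (fun y => Real.sin (θ y)) x = Real.cos (θ x) • ∇ θ x := fun x => by
    rw [gradient, fderiv_sin (hθ.differentiable (by simp)).differentiableAt, map_smul]; rfl
  have hc : ∀ x, ∇ (fun y => Real.cos (θ y)) x = -Real.sin (θ x) • ∇ θ x := fun x => by
    rw [gradient, fderiv_cos (hθ.differentiable (by simp)).differentiableAt, map_smul]; rfl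
  refine ⟨fun x => Real.sin (θ x), fun x => Real.cos (θ x), r + 1, C ^ 2,
    Real.contDiff_sin.comp hθ, Real.contDiff_cos.comp hθ, fun x => Real.sin_sq_add_cos_sq _,
    fun x hx => ?_, fun x hx => ?_, by positivity, fun x => ?_⟩
  · have : f x = 1 := f.one_of_mem_closedBall (Metric.closedBall_subset_closedBall (le_max_left _ _) hx)
    simp [θ, this]
  · have : f x = 0 := f.zero_of_le_dist (not_le.1 fun h => hx h).le
    simp [θ, this]
  · rw [hs, hc, norm_smul, norm_smul, mul_pow, mul_pow, Real.norm_eq_abs, Real.norm_eq_abs, sq_abs,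
      sq_abs, neg_sq, ← add_mul, Real.cos_sq_add_sin_sq, one_mul]
    have := hC x
    gcongr

theorem integral_mul_sq_le (hu : IsGlobalClassicalSolution u) {C : ℝ}
    {b : EuclideanSpace ℝ (Fin n) → ℝ} (h0 : ∀ x, 0 ≤ b x) (hb : ∀ x, b x ≤ C)
    (hφ : φ ∈ testFunctions u) :
    ∫ x, b x * φ x ^ 2 ∂(phaseMeasure u) ≤ C * ∫ x, φ x ^ 2 ∂(phaseMeasure u) := by
  rw [← integral_const_mul]
  refine integral_mono_of_nonneg (ae_of_all _ fun x => mul_nonneg (h0 x) (sq_nonneg _))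
    ((memLp_phase hu hφ 2).integrable_sq.const_mul C)
    (ae_of_all _ fun x => mul_le_mul_of_nonneg_right (hb x) (sq_nonneg _))

end Cutoff

/-! ### Gårding's inequality on a ball. -/

section Garding

theorem exists_trace_inequality_real (hu : IsGlobalClassicalSolution u) (R : ℝ) {ε : ℝ}
    (hε : 0 < ε) : ∃ C : ℝ, 0 ≤ C ∧ ∀ ψ ∈ testFunctions u,
      ∫ x in Metric.closedBall 0 R, ψ x ^ 2 ∂(bdryMeasure u) ≤
        ε * (∫ x, ‖∇ ψ x‖ ^ 2 ∂(phaseMeasure u)) + C * ∫ x, ψ x ^ 2 ∂(phaseMeasure u) := by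
  obtain ⟨C, hC, h⟩ := (exists_trace_inequality hu R).2 ε hε
  refine ⟨C, hC, fun ψ hψ => ?_⟩
  have h1 : 0 ≤ ∫ x, ‖∇ ψ x‖ ^ 2 ∂(phaseMeasure u) := integral_nonneg fun _ => by positivity
  have h2 := integral_sq_nonneg (phaseMeasure u) ψ
  rw [← ENNReal.ofReal_le_ofReal_iff (by positivity), ofReal_integral_eq_lintegral_ofReal
    (memLp_bdry hu hψ 2).integrable_sq.integrableOn (ae_of_all _ fun _ => sq_nonneg _)]
  exact h ψ hψ

/-- Gårding's inequality for test functions supported in a fixed ball. -/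
theorem exists_garding (hu : IsGlobalClassicalSolution u) (R : ℝ) :
    ∃ C : ℝ, 0 ≤ C ∧ ∀ φ ∈ testFunctions u, (∀ x ∉ Metric.closedBall 0 R, φ x = 0) →
      1 / 2 * (∫ x, ‖∇ φ x‖ ^ 2 ∂(phaseMeasure u)) - C * ∫ x, φ x ^ 2 ∂(phaseMeasure u) ≤
        secondVariation u φ φ := by
  obtain ⟨M, hM0, hM⟩ := exists_meanCurvature_bound hu R
  -- With `ε = 1 / (2M)` and `|H| ≤ M`, the boundary term absorbs exactly half of the Dirichlet
  -- energy.
  obtain ⟨C, hC, h⟩ := exists_trace_inequality_real hu R (ε := 1 / (2 * M)) (by positivity)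
  refine ⟨M * C, by positivity, fun φ hφ hφ0 => ?_⟩
  have h1 : ∫ x, meanCurvature u x * φ x * φ x ∂(bdryMeasure u) ≤
      M * ∫ x in Metric.closedBall 0 R, φ x ^ 2 ∂(bdryMeasure u) := by
    rw [setIntegral_eq_integral_of_forall_compl_eq_zero fun x hx => by simp [hφ0 x hx],
      ← integral_const_mul]
    refine integral_mono_ae (integrable_meanCurvature_mul_mul hu hφ hφ)
      ((memLp_bdry hu hφ 2).integrable_sq.const_mul M)
      ((ae_restrict_iff' isClosed_freeBdry.measurableSet).2 (ae_of_all _ fun x hx => ?_))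
    by_cases hxR : x ∈ Metric.closedBall (0 : EuclideanSpace ℝ (Fin n)) R
    · have := (abs_le.1 (hM x ⟨hx, hxR⟩)).2
      beta_reduce
      nlinarith [sq_nonneg (φ x)]
    · simp [hφ0 x hxR]
  have h2 := h φ hφ
  have h3 : ∫ x, ⟪∇ φ x, ∇ φ x⟫ ∂(phaseMeasure u) = ∫ x, ‖∇ φ x‖ ^ 2 ∂(phaseMeasure u) := by
    simp only [real_inner_self_eq_norm_sq]
  rw [secondVariation, h3]
  have h4 := mul_le_mul_of_nonneg_left h2 hM0.le
  have h5 : M * (1 / (2 * M) * (∫ x, ‖∇ φ x‖ ^ 2 ∂(phaseMeasure u))) =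
      1 / 2 * (∫ x, ‖∇ φ x‖ ^ 2 ∂(phaseMeasure u)) := by field_simp
  rw [mul_add, h5] at h4
  linarith

end Garding

end OnePhase

/-! ### Linear algebra of forms of finite negative index. -/

section NegativeGram

/-- A square array of reals defines a negative definite quadratic form. -/
def IsNegDef {k : ℕ} (M : Fin k → Fin k → ℝ) : Prop :=
  ∀ c : Fin k → ℝ, c ≠ 0 → ∑ i, ∑ j, c i * c j * M i j < 0

/-- By homogeneity it is enough to test on the unit sphere, whose compactness makes negative
definiteness an open condition on the entries. Negative tuples can therefore be replaced by
approximations. -/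
theorem IsNegDef.eventually {k : ℕ} {M : Fin k → Fin k → ℝ} (hM : IsNegDef M) {α : Type*}
    {l : Filter α} {N : α → Fin k → Fin k → ℝ}
    (hN : ∀ i j, Tendsto (fun a => N a i j) l (𝓝 (M i j))) : ∀ᶠ a in l, IsNegDef (N a) := by
  have hN' : Tendsto N l (𝓝 M) := tendsto_pi_nhds.2 fun i => tendsto_pi_nhds.2 fun j => hN i j
  have h : ∀ᶠ N in 𝓝 M, ∀ c ∈ Metric.sphere (0 : Fin k → ℝ) 1,
      ∑ i, ∑ j, c i * c j * N i j < 0 := by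
    refine (isCompact_sphere _ _).eventually_forall_of_forall_eventually fun c hc => ?_
    have hc0 : c ≠ 0 := by
      rintro rfl
      simp at hc
    have hcont : Continuous fun z : (Fin k → Fin k → ℝ) × (Fin k → ℝ) =>
        ∑ i, ∑ j, z.2 i * z.2 j * z.1 i j := by fun_prop
    exact hcont.continuousAt.eventually_lt continuousAt_const (hM c hc0)
  filter_upwards [hN'.eventually h] with a ha
  intro c hc
  have hc0 : 0 < ‖c‖ := norm_pos_iff.2 hc
  have := ha (‖c‖⁻¹ • c) (by simp [norm_smul, hc0.ne'])
  have h2 : ∑ i, ∑ j, c i * c j * N a i j =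
      ‖c‖ ^ 2 * ∑ i, ∑ j, (‖c‖⁻¹ • c) i * (‖c‖⁻¹ • c) j * N a i j := by
    rw [Finset.mul_sum]
    refine Finset.sum_congr rfl fun i _ => ?_
    rw [Finset.mul_sum]
    refine Finset.sum_congr rfl fun j _ => ?_
    simp only [Pi.smul_apply, smul_eq_mul]
    field_simp
  rw [h2]
  exact mul_neg_of_pos_of_neg (by positivity) this

theorem isNegDef_fin_zero (M : Fin 0 → Fin 0 → ℝ) : IsNegDef M :=
  fun _ hc => (hc (Subsingleton.elim _ _)).elim

theorem isNegDef_of_diagonal {k : ℕ} {d : Fin k → ℝ} (hd : ∀ i, d i < 0) :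
    IsNegDef fun i j => if i = j then d i else 0 := by
  intro c hc
  obtain ⟨i, hi⟩ := Function.ne_iff.1 hc
  have : ∀ i, ∑ j, c i * c j * (if i = j then d i else 0) = c i ^ 2 * d i := fun i => by
    simp [pow_two]
  simp only [this]
  refine Finset.sum_neg' (fun j _ => mul_nonpos_of_nonneg_of_nonpos (sq_nonneg _) (hd j).le)
    ⟨i, Finset.mem_univ _, mul_neg_of_pos_of_neg (sq_pos_of_ne_zero hi) (hd i)⟩

variable {D : Type*} [AddCommGroup D] [Module ℝ D] {B : LinearMap.BilinForm ℝ D}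

theorem bilinForm_sum_smul {k : ℕ} (x : Fin k → D) (c : Fin k → ℝ) :
    B (∑ i, c i • x i) (∑ i, c i • x i) = ∑ i, ∑ j, c i * c j * B (x i) (x j) := by
  simp only [map_sum, map_smul, LinearMap.sum_apply, LinearMap.smul_apply, smul_eq_mul]
  simp only [Finset.mul_sum]
  rw [Finset.sum_comm]
  exact Finset.sum_congr rfl fun i _ => Finset.sum_congr rfl fun j _ => by ring

/-- The negative index of `B` is at most `K`. -/
def NegIndexLE (B : LinearMap.BilinForm ℝ D) (K : ℕ) : Prop :=
  ∀ (k : ℕ) (x : Fin k → D), IsNegDef (fun i j => B (x i) (x j)) → k ≤ K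

theorem IsNegDef.snoc {k : ℕ} {x : Fin k → D} (hx : IsNegDef fun i j => B (x i) (x j)) {z : D}
    (hz : B z z < 0) (hxz : ∀ i, B (x i) z = 0) (hzx : ∀ i, B z (x i) = 0) :
    IsNegDef fun i j => B (Fin.snoc (α := fun _ => D) x z i) (Fin.snoc (α := fun _ => D) x z j) := by
  intro c hc
  simp only [Fin.sum_univ_castSucc, Fin.snoc_castSucc, Fin.snoc_last, hxz, hzx, mul_zero,
    add_zero, Finset.sum_const_zero, zero_add]
  have h2 : c (Fin.last k) * c (Fin.last k) * B z z ≤ 0 :=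
    mul_nonpos_of_nonneg_of_nonpos (mul_self_nonneg _) hz.le
  by_cases h : (fun i : Fin k => c i.castSucc) = 0
  · have hl : c (Fin.last k) ≠ 0 := fun hl => hc (by
      ext i
      refine Fin.lastCases hl (fun i => congr_fun h i) i)
    have h0 : ∀ i : Fin k, c i.castSucc = 0 := fun i => congr_fun h i
    simp only [h0, zero_mul, Finset.sum_const_zero, zero_add]
    exact mul_neg_of_pos_of_neg (mul_self_pos.2 hl) hz
  · linarith [hx _ h]

/-- A tuple of maximal length among those with negative definite Gram matrix. -/
theorem NegIndexLE.exists_maximal {K : ℕ} (hK : NegIndexLE B K) :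
    ∃ (k : ℕ) (x : Fin k → D), IsNegDef (fun i j => B (x i) (x j)) ∧ NegIndexLE B k := by
  classical
  set P : ℕ → Prop := fun k => ∃ x : Fin k → D, IsNegDef fun i j => B (x i) (x j)
  have h0 : P 0 := ⟨Fin.elim0, isNegDef_fin_zero _⟩
  obtain ⟨x, hx⟩ := Nat.findGreatest_spec (P := P) (zero_le : 0 ≤ K) h0
  exact ⟨_, x, hx, fun k y hy => Nat.le_findGreatest (hK k y hy) ⟨y, hy⟩⟩

/-- `B` is nonnegative on the `B`-orthogonal complement of a maximal negative tuple. -/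
theorem NegIndexLE.nonneg_of_orthogonal {k : ℕ} (hk : NegIndexLE B k) (hB : ∀ x y, B x y = B y x)
    {x : Fin k → D} (hx : IsNegDef fun i j => B (x i) (x j)) {z : D}
    (hz : ∀ i, B z (x i) = 0) : 0 ≤ B z z := by
  by_contra! h
  have := hk (k + 1) _ (hx.snoc h (fun i => by rw [hB, hz]) hz)
  omega

end NegativeGram

/-! ### Negative eigenvectors of bounded symmetric operators. -/

section Hilbert

variable {H : Type*} [NormedAddCommGroup H] [InnerProductSpace ℝ H]

/-- The quadratic form of a bounded operator as a bilinear form. -/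
noncomputable def operatorForm (A : H →L[ℝ] H) : LinearMap.BilinForm ℝ H :=
  LinearMap.mk₂ ℝ (fun x y => ⟪A x, y⟫) (fun x y z => by simp [inner_add_left])
    (fun c x y => by simp [real_inner_smul_left]) (fun x y z => by simp [inner_add_right])
    (fun c x y => by simp [real_inner_smul_right])

@[simp]
theorem operatorForm_apply (A : H →L[ℝ] H) (x y : H) : operatorForm A x y = ⟪A x, y⟫ := rfl

theorem operatorForm_comm {A : H →L[ℝ] H} (hA : ∀ x y, ⟪A x, y⟫ = ⟪x, A y⟫) (x y : H) :
    operatorForm A x y = operatorForm A y x := by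
  rw [operatorForm_apply, operatorForm_apply, hA, real_inner_comm]

/-- The form of `A - m` is nonnegative and vanishes at `v`. Cauchy–Schwarz for this form, applied to
`v` and `(A - m) v`, gives `(A - m) v = 0`. -/
theorem map_eq_smul_of_quadratic_min {A : H →L[ℝ] H} (hA : ∀ x y, ⟪A x, y⟫ = ⟪x, A y⟫) {m : ℝ}
    (hm : ∀ x, m * ‖x‖ ^ 2 ≤ ⟪A x, x⟫) {v : H} (hv : ⟪A v, v⟫ = m * ‖v‖ ^ 2) : A v = m • v := by
  set A' : H →L[ℝ] H := A - m • ContinuousLinearMap.id ℝ H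
  have hA' : ∀ x y, ⟪A' x, y⟫ = ⟪x, A' y⟫ := fun x y => by
    simp [A', inner_sub_left, inner_sub_right, hA, real_inner_smul_left, real_inner_smul_right]
  have hform : ∀ x, operatorForm A' x x = ⟪A x, x⟫ - m * ‖x‖ ^ 2 := fun x => by
    simp [A', inner_sub_left, real_inner_smul_left]
  have hcs := (operatorForm A').apply_sq_le_of_symm
    (fun x => by rw [hform]; linarith [hm x]) ⟨fun x y => operatorForm_comm hA' x y⟩ v (A' v)
  rw [hform v, hv, sub_self, zero_mul, operatorForm_apply] at hcs
  have h0 : ⟪A' v, A' v⟫ = 0 := by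
    have := sq_nonneg ⟪A' v, A' v⟫
    exact pow_eq_zero_iff (two_ne_zero) |>.1 (le_antisymm hcs this)
  have h1 : A' v = 0 := inner_self_eq_zero.1 h0
  simpa [A', sub_eq_zero] using h1

/-- A symmetric bounded operator of finite, nonzero negative index has a negative eigenvalue. -/
theorem exists_negative_eigenvector [CompleteSpace H] {A : H →L[ℝ] H}
    (hA : ∀ x y, ⟪A x, y⟫ = ⟪x, A y⟫) {K : ℕ} (hK : NegIndexLE (operatorForm A) K) {x₀ : H}
    (hx₀ : ⟪A x₀, x₀⟫ < 0) : ∃ (v : H) (m : ℝ), ‖v‖ = 1 ∧ m < 0 ∧ A v = m • v := by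
  obtain ⟨k, x, hx, hk⟩ := hK.exists_maximal
  have hZ : ∀ z, (∀ i, ⟪A z, x i⟫ = 0) → 0 ≤ ⟪A z, z⟫ := fun z hz =>
    hk.nonneg_of_orthogonal (operatorForm_comm hA) hx hz
  -- The composite `L ∘ S` is given by the Gram matrix of the maximal tuple, which is invertible by
  -- definiteness. With `T = L ∘ S`, every `y` splits as `S (T⁻¹ (L y))` plus a vector
  -- `A`-orthogonal to the tuple, and on such vectors `A` is nonnegative.
  let S : (Fin k → ℝ) →ₗ[ℝ] H := Fintype.linearCombination ℝ x
  let L : H →ₗ[ℝ] (Fin k → ℝ) := LinearMap.pi fun i => (operatorForm A).flip (x i)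
  have hS : ∀ c, S c = ∑ i, c i • x i := fun c => Fintype.linearCombination_apply ..
  have hL : ∀ y i, L y i = ⟪A y, x i⟫ := fun y i => rfl
  have hinj : Function.Injective (L ∘ₗ S) := by
    rw [injective_iff_map_eq_zero]
    intro c hc
    by_contra hc0
    have h1 := hx c hc0
    rw [← bilinForm_sum_smul, ← hS] at h1
    have h2 : operatorForm A (S c) (S c) = ∑ i, c i * L (S c) i := by
      conv_lhs => rw [hS c]
      rw [map_sum]
      refine Finset.sum_congr rfl fun i _ => ?_
      rw [map_smul, smul_eq_mul, ← hS]
      rfl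
    have h3 : L (S c) = 0 := hc
    rw [h2, h3] at h1
    simp at h1
  let T : (Fin k → ℝ) ≃ₗ[ℝ] (Fin k → ℝ) := LinearEquiv.ofInjectiveEndo _ hinj
  have hT : ∀ c, T c = L (S c) := fun c => rfl
  let a : H → Fin k → ℝ := fun y => T.symm (L y)
  have haZ : ∀ y, L (y - S (a y)) = 0 := fun y => by
    rw [map_sub, ← hT, T.apply_symm_apply, sub_self]
  -- The infimum of the Rayleigh quotient.
  set R : Set ℝ := (fun x => ⟪A x, x⟫) '' Metric.sphere (0 : H) 1
  have hbound : ∀ x, |⟪A x, x⟫| ≤ ‖A‖ * ‖x‖ ^ 2 := fun x => by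
    refine (abs_real_inner_le_norm _ _).trans ?_
    rw [pow_two, ← mul_assoc]
    exact mul_le_mul_of_nonneg_right (A.le_opNorm x) (norm_nonneg _)
  have hRb : BddBelow R := ⟨-‖A‖, by
    rintro _ ⟨x, hx, rfl⟩
    have := (abs_le.1 (hbound x)).1
    rw [mem_sphere_zero_iff_norm.1 hx] at this
    simpa using this⟩
  have hx₀0 : x₀ ≠ 0 := by rintro rfl; simp at hx₀
  have hnorm : ∀ x : H, x ≠ 0 → ‖x‖⁻¹ • x ∈ Metric.sphere (0 : H) 1 := fun x hx => by
    rw [mem_sphere_zero_iff_norm, norm_smul, norm_inv, norm_norm,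
      inv_mul_cancel₀ (norm_ne_zero_iff.2 hx)]
  have hscale : ∀ x : H, x ≠ 0 →
      ⟪A (‖x‖⁻¹ • x), ‖x‖⁻¹ • x⟫ * ‖x‖ ^ 2 = ⟪A x, x⟫ := fun x hx => by
    have := norm_ne_zero_iff.2 hx
    rw [map_smul, real_inner_smul_left, real_inner_smul_right]
    field_simp
  have hRne : R.Nonempty := ⟨_, _, hnorm x₀ hx₀0, rfl⟩
  set m := sInf R
  have hm0 : m < 0 := by
    refine (csInf_le hRb ⟨_, hnorm x₀ hx₀0, rfl⟩).trans_lt ?_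
    have h1 := hscale x₀ hx₀0
    have h2 : 0 < ‖x₀‖ ^ 2 := by positivity
    beta_reduce
    by_contra! h
    nlinarith
  have hm : ∀ x, m * ‖x‖ ^ 2 ≤ ⟪A x, x⟫ := fun x => by
    rcases eq_or_ne x 0 with rfl | hx
    · simp
    · rw [← hscale x hx]
      exact mul_le_mul_of_nonneg_right (csInf_le hRb ⟨_, hnorm x hx, rfl⟩) (sq_nonneg _)
  obtain ⟨r, -, hrlim, hrR⟩ := exists_seq_tendsto_sInf hRne hRb
  choose y hy hyr using hrR
  have hy1 : ∀ i, ‖y i‖ = 1 := fun i => mem_sphere_zero_iff_norm.1 (hy i)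
  obtain ⟨Ca, hCa⟩ : ∃ C, ∀ i, a (y i) ∈ Metric.closedBall (0 : Fin k → ℝ) C := by
    let Lc : H →L[ℝ] (Fin k → ℝ) :=
      ContinuousLinearMap.pi fun i => (innerSL ℝ (x i)).comp A
    have hLc : ∀ y, Lc y = L y := fun y => by
      ext i
      simp [Lc, hL, real_inner_comm]
    let P : H →L[ℝ] (Fin k → ℝ) := (LinearMap.toContinuousLinearMap T.symm.toLinearMap).comp Lc
    refine ⟨‖P‖, fun i => ?_⟩
    have h1 : a (y i) = P (y i) := by
      simp [a, P, hLc]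
    rw [mem_closedBall_zero_iff, h1]
    simpa [hy1] using P.le_opNorm (y i)
  obtain ⟨a₀, -, s, hs, hlim⟩ := (isCompact_closedBall (0 : Fin k → ℝ) Ca).tendsto_subseq hCa
  set w : ℕ → H := fun i => S (a (y (s i)))
  have hSc : Continuous S := S.continuous_of_finiteDimensional
  have hwlim : Tendsto w atTop (𝓝 (S a₀)) := (hSc.tendsto a₀).comp hlim
  set z : ℕ → H := fun i => y (s i) - w i
  -- `q` is a nonnegative quadratic form that tends to zero along the minimizing sequence. On the
  -- complement of the tuple it dominates `-m ‖·‖²`, where `-m > 0`; this is the coercivity that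
  -- makes `z` Cauchy.
  set q : H → ℝ := fun x => ⟪A x, x⟫ - m * ‖x‖ ^ 2 with hq
  have hq0 : ∀ x, 0 ≤ q x := fun x => sub_nonneg.2 (hm x)
  have hqsub : ∀ x y, q (x - y) ≤ 2 * q x + 2 * q y := fun x y => by
    have h1 : q (x - y) + q (x + y) = 2 * q x + 2 * q y := by
      simp only [hq, map_sub, map_add, inner_sub_left, inner_sub_right, inner_add_left,
        inner_add_right, norm_sub_sq_real, norm_add_sq_real]
      ring
    linarith [hq0 (x + y)]
  have hqle : ∀ x, q x ≤ (‖A‖ - m) * ‖x‖ ^ 2 := fun x => by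
    have := (abs_le.1 (hbound x)).2
    simp only [hq]
    linarith
  have hqlim : Tendsto (fun i => q (y (s i))) atTop (𝓝 0) := by
    have h1 : ∀ i, q (y (s i)) = r (s i) - m := fun i => by
      simp only [hq, hy1, ← hyr]
      ring
    simp only [h1]
    simpa [m] using (hrlim.comp hs.tendsto_atTop).sub_const m
  have hzq : ∀ i j, -m * ‖z i - z j‖ ^ 2 ≤ q (z i - z j) := fun i j => by
    have : 0 ≤ ⟪A (z i - z j), z i - z j⟫ := by
      refine hZ _ fun l => ?_
      rw [← hL, map_sub]
      simp [z, w, haZ]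
    simp only [hq]
    linarith
  have hwC : CauchySeq w := hwlim.cauchySeq
  have hzC : CauchySeq z := by
    rw [Metric.cauchySeq_iff]
    intro ε hε
    -- Put `δ = -m ε²`. The `y` terms contribute less than `8 · δ/16` and the `w` term less than `2
    -- · δ/16`, so `q (z i - z j) < δ`.
    have hδ : 0 < -m * ε ^ 2 := by have := neg_pos.2 hm0; positivity
    have hAm : 0 < ‖A‖ - m := by linarith [norm_nonneg A]
    obtain ⟨N₁, hN₁⟩ := eventually_atTop.1
      (hqlim.eventually (gt_mem_nhds (show (0 : ℝ) < -m * ε ^ 2 / 16 by positivity)))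
    obtain ⟨N₂, hN₂⟩ := Metric.cauchySeq_iff.1 hwC
      (Real.sqrt (-m * ε ^ 2 / (16 * (‖A‖ - m)))) (Real.sqrt_pos.2 (by positivity))
    refine ⟨max N₁ N₂, fun i hi j hj => ?_⟩
    have h1 := hN₁ i ((le_max_left _ _).trans hi)
    have h2 := hN₁ j ((le_max_left _ _).trans hj)
    have h3 := hN₂ i ((le_max_right _ _).trans hi) j ((le_max_right _ _).trans hj)
    rw [dist_eq_norm, Real.lt_sqrt (norm_nonneg _), lt_div_iff₀ (by positivity)] at h3
    have h4 : q (z i - z j) ≤ 2 * q (y (s i) - y (s j)) + 2 * q (w i - w j) := by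
      have : z i - z j = (y (s i) - y (s j)) - (w i - w j) := by simp only [z]; abel
      rw [this]
      exact hqsub _ _
    have h5 := hqsub (y (s i)) (y (s j))
    have h6 := hqle (w i - w j)
    have h7 := hzq i j
    have h8 : -m * ‖z i - z j‖ ^ 2 < -m * ε ^ 2 := by nlinarith
    have h9 := lt_of_mul_lt_mul_left h8 (neg_pos.2 hm0).le
    rw [dist_eq_norm]
    exact lt_of_pow_lt_pow_left₀ 2 hε.le h9
  obtain ⟨z₀, hz₀⟩ := cauchySeq_tendsto_of_complete hzC
  have hylim : Tendsto (fun i => y (s i)) atTop (𝓝 (z₀ + S a₀)) := by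
    have := hz₀.add hwlim
    simpa only [z, sub_add_cancel] using this
  refine ⟨z₀ + S a₀, m, ?_, hm0, map_eq_smul_of_quadratic_min hA hm ?_⟩
  · have := hylim.norm
    simp only [hy1] at this
    exact (tendsto_nhds_unique tendsto_const_nhds this).symm
  · have hqc : Continuous q := by fun_prop
    have := tendsto_nhds_unique ((hqc.tendsto _).comp hylim) hqlim
    simp only [hq] at this
    linarith

/-- A symmetric bounded operator of finite negative index is nonnegative on the complement of a
finite orthonormal family of eigenvectors with negative eigenvalues. -/
theorem exists_negative_eigenbasis [CompleteSpace H] {A : H →L[ℝ] H}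
    (hA : ∀ x y, ⟪A x, y⟫ = ⟪x, A y⟫) {K : ℕ} (hK : NegIndexLE (operatorForm A) K) :
    ∃ (k : ℕ) (v : Fin k → H) (m : Fin k → ℝ), Orthonormal ℝ v ∧ (∀ i, m i < 0) ∧
      (∀ i, A (v i) = m i • v i) ∧ ∀ y, (∀ i, ⟪v i, y⟫ = 0) → 0 ≤ ⟪A y, y⟫ := by
  classical
  -- An orthonormal family of negative eigenvectors has a negative diagonal Gram matrix, so its size
  -- is at most `K` and a largest family exists.
  set P : ℕ → Prop := fun k => ∃ (v : Fin k → H) (m : Fin k → ℝ), Orthonormal ℝ v ∧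
    (∀ i, m i < 0) ∧ ∀ i, A (v i) = m i • v i
  have hPK : ∀ k, P k → k ≤ K := by
    rintro k ⟨v, m, hv, hm, hAv⟩
    refine hK k v ?_
    convert isNegDef_of_diagonal hm using 3 with i j
    rw [operatorForm_apply, hAv, real_inner_smul_left, orthonormal_iff_ite.1 hv]
    simp
  have h0 : P 0 := ⟨Fin.elim0, Fin.elim0, ⟨fun i => i.elim0, fun i => i.elim0⟩,
    fun i => i.elim0, fun i => i.elim0⟩
  obtain ⟨k, ⟨v, m, hv, hm, hAv⟩, hmax⟩ : ∃ k, P k ∧ ∀ j, P j → j ≤ k :=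
    ⟨_, Nat.findGreatest_spec (P := P) (zero_le : 0 ≤ K) h0,
      fun j hj => Nat.le_findGreatest (hPK j hj) hj⟩
  refine ⟨k, v, m, hv, hm, hAv, fun y hy => ?_⟩
  by_contra! hneg
  -- Removing the known eigenvectors raises the form, so the index bound persists. `A'` kills each
  -- `v i`, so by symmetry an eigenvector of `A'` with nonzero eigenvalue is orthogonal to all of
  -- them; it is then an eigenvector of `A` and enlarges the maximal family.
  set A' : H →L[ℝ] H := A - ∑ i, m i • (innerSL ℝ (v i)).smulRight (v i)
  have hA'x : ∀ x, A' x = A x - ∑ i, (m i * ⟪v i, x⟫) • v i := fun x => by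
    simp [A', smul_smul]
  have hA'xy : ∀ x y, ⟪A' x, y⟫ = ⟪A x, y⟫ - ∑ i, m i * ⟪v i, x⟫ * ⟪v i, y⟫ := fun x y => by
    rw [hA'x, inner_sub_left, sum_inner]
    simp only [real_inner_smul_left]
  have hA' : ∀ x y, ⟪A' x, y⟫ = ⟪x, A' y⟫ := fun x y => by
    rw [real_inner_comm (A' y) x, hA'xy, hA'xy, hA, real_inner_comm (A y) x]
    congr 1
    exact Finset.sum_congr rfl fun i _ => by ring
  have hK' : NegIndexLE (operatorForm A') K := fun j x hx => by
    refine hK j x fun c hc => ?_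
    have h1 := hx c hc
    rw [← bilinForm_sum_smul, operatorForm_apply] at h1 ⊢
    rw [hA'xy] at h1
    have : ∑ i, m i * ⟪v i, ∑ i, c i • x i⟫ * ⟪v i, ∑ i, c i • x i⟫ ≤ 0 :=
      Finset.sum_nonpos fun i _ => by
        rw [mul_assoc]
        exact mul_nonpos_of_nonpos_of_nonneg (hm i).le (mul_self_nonneg _)
    linarith
  obtain ⟨w, μ, hw, hμ, hAw⟩ := exists_negative_eigenvector hA' hK' (x₀ := y) (by
    rw [hA'xy]; simpa [hy] using hneg)
  have hA'v : ∀ i, A' (v i) = 0 := fun i => by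
    rw [hA'x, hAv]
    simp [orthonormal_iff_ite.1 hv]
  have hvw : ∀ i, ⟪v i, w⟫ = 0 := fun i => by
    have h1 := hA' (v i) w
    rw [hA'v, inner_zero_left, hAw, real_inner_smul_right] at h1
    exact (mul_eq_zero.1 h1.symm).resolve_left hμ.ne
  have hAw' : A w = μ • w := by
    rw [← hAw, hA'x]
    simp [hvw]
  have hP : P (k + 1) := by
    refine ⟨Fin.snoc (α := fun _ => H) v w, Fin.snoc (α := fun _ => ℝ) m μ, ?_, ?_, ?_⟩
    · rw [orthonormal_iff_ite]
      intro i j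
      refine Fin.lastCases ?_ (fun i => ?_) i <;> refine Fin.lastCases ?_ (fun j => ?_) j
      · simp [hw]
      · rw [Fin.snoc_last, Fin.snoc_castSucc, real_inner_comm, hvw]
        simp [(Fin.castSucc_lt_last j).ne']
      · simp [hvw, (Fin.castSucc_lt_last i).ne]
      · rw [Fin.snoc_castSucc, Fin.snoc_castSucc, orthonormal_iff_ite.1 hv]
        simp
    · intro i
      refine Fin.lastCases ?_ (fun i => ?_) i
      · simpa using hμ
      · simpa using hm i
    · intro i
      refine Fin.lastCases ?_ (fun i => ?_) i
      · simpa using hAw'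
      · simpa using hAv i
  have := hmax _ hP
  omega

end Hilbert

/-! ### From a semibounded form to a bounded operator on its completion. -/

section Friedrichs

open UniformSpace

/-- A semibounded symmetric form of finite negative index on a space `D` with a linear map to a
Hilbert space `X` has a finite orthonormal family of generalized eigenvectors with negative
eigenvalues, each approximated by elements of `D`, whose orthogonal complement in `D` carries no
negative direction of the form. -/
theorem exists_generalized_negative_eigenbasis {D X : Type*} [AddCommGroup D] [Module ℝ D]
    [NormedAddCommGroup X] [InnerProductSpace ℝ X] [CompleteSpace X]
    {B : LinearMap.BilinForm ℝ D} (hB : ∀ x y, B x y = B y x) (ι : D →ₗ[ℝ] X) {c : ℝ} (hc : 0 < c)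
    (hlow : ∀ x, ‖ι x‖ ^ 2 ≤ B x x + c * ‖ι x‖ ^ 2) {K : ℕ} (hK : NegIndexLE B K) :
    ∃ (k : ℕ) (φ : Fin k → X) (l : Fin k → ℝ) (f : Fin k → ℕ → D), Orthonormal ℝ φ ∧
      (∀ i, l i < 0) ∧ (∀ i, Tendsto (fun m => ι (f i m)) atTop (𝓝 (φ i))) ∧
      (∀ i, ∀ ε : ℝ, 0 < ε → ∃ N, ∀ m ≥ N, ∀ m' ≥ N, B (f i m - f i m') (f i m - f i m') +
        c * ‖ι (f i m - f i m')‖ ^ 2 < ε) ∧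
      (∀ i x, Tendsto (fun m => B (f i m) x) atTop (𝓝 (l i * ⟪φ i, ι x⟫))) ∧
      ∀ x, (∀ i, ⟪φ i, ι x⟫ = 0) → 0 ≤ B x x := by
  -- Only a seminorm is needed, since `ι` need not be injective; the completion identifies vectors
  -- at distance zero.
  let core : PreInnerProductSpace.Core ℝ D :=
    { inner := fun x y => B x y + c * ⟪ι x, ι y⟫
      conj_inner_symm := fun x y => by
        simp only [conj_trivial]
        rw [hB, real_inner_comm]
      re_inner_nonneg := fun x => by
        rw [real_inner_self_eq_norm_sq]
        exact (sq_nonneg _).trans (hlow x)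
      add_left := fun x y z => by
        simp only [map_add, LinearMap.add_apply, inner_add_left]
        ring
      smul_left := fun x y r => by
        simp only [map_smul, LinearMap.smul_apply, smul_eq_mul, real_inner_smul_left, conj_trivial]
        ring }
  let _ : SeminormedAddCommGroup D :=
    @InnerProductSpace.Core.toSeminormedAddCommGroup ℝ D _ _ _ core
  let _ : InnerProductSpace ℝ D := InnerProductSpace.ofCore core
  have hinner : ∀ x y : D, ⟪x, y⟫ = B x y + c * ⟪ι x, ι y⟫ := fun x y => rfl
  have hnormsq : ∀ x : D, ‖x‖ ^ 2 = B x x + c * ‖ι x‖ ^ 2 := fun x => by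
    rw [← real_inner_self_eq_norm_sq, hinner, real_inner_self_eq_norm_sq]
  let j : D →L[ℝ] Completion D := Completion.toComplL
  have hj : ∀ x, j x = (x : Completion D) := fun x => rfl
  have hjinner : ∀ x y, ⟪j x, j y⟫ = B x y + c * ⟪ι x, ι y⟫ := fun x y => by
    rw [hj, hj, Completion.inner_coe, hinner]
  have hjnorm : ∀ x, ‖j x‖ = ‖x‖ := fun x => Completion.norm_coe x
  have hdense : DenseRange j := Completion.denseRange_coe
  have hle : ∀ x, ‖ι x‖ ≤ 1 * ‖j x‖ := fun x => by
    rw [one_mul, hjnorm]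
    refine le_of_sq_le_sq ?_ (norm_nonneg _)
    rw [hnormsq]
    exact hlow x
  let J : Completion D →L[ℝ] X := ι.extendOfNorm j.toLinearMap
  have hJ : ∀ x, J (j x) = ι x := fun x =>
    LinearMap.extendOfNorm_eq (e := j.toLinearMap) hdense ⟨1, hle⟩ x
  -- On the image of `D` the scalar product is `B + c ⟪ι ·, ι ·⟫`, so subtracting `c J*J` leaves
  -- exactly `B`.
  let A : Completion D →L[ℝ] Completion D :=
    ContinuousLinearMap.id ℝ _ - c • (ContinuousLinearMap.adjoint J).comp J
  have hA : ∀ x y, ⟪A x, y⟫ = ⟪x, y⟫ - c * ⟪J x, J y⟫ := fun x y => by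
    simp [A, inner_sub_left, real_inner_smul_left, ContinuousLinearMap.adjoint_inner_left]
  have hAsymm : ∀ x y, ⟪A x, y⟫ = ⟪x, A y⟫ := fun x y => by
    rw [real_inner_comm (A y) x, hA, hA, real_inner_comm, real_inner_comm (J y)]
  have hAj : ∀ x y, ⟪A (j x), j y⟫ = B x y := fun x y => by
    rw [hA, hjinner, hJ, hJ, add_sub_cancel_right]
  have hseq : ∀ y, ∃ f : ℕ → D, Tendsto (fun m => j (f m)) atTop (𝓝 y) := fun y => by
    obtain ⟨g, hg, hlim⟩ := mem_closure_iff_seq_limit.1 (hdense y)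
    choose f hf using hg
    exact ⟨f, by simpa only [hf] using hlim⟩
  -- A negative tuple in the completion is approximated by tuples from `D`, whose Gram matrices are
  -- eventually negative definite.
  have hKA : NegIndexLE (operatorForm A) K := fun k x hx => by
    choose f hf using fun i => hseq (x i)
    have hev := hx.eventually (l := atTop) (N := fun m a b => B (f a m) (f b m)) fun a b => by
      simp only [← hAj]
      exact ((A.continuous.tendsto _).comp (hf a)).inner (hf b)
    obtain ⟨m, hm⟩ := hev.exists
    exact hK k _ hm
  obtain ⟨k, v, m, hv, hm, hAv, hnn⟩ := exists_negative_eigenbasis hAsymm hKA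
  have h1m : ∀ i, 0 < 1 - m i := fun i => by linarith [hm i]
  have heig : ∀ i y, (1 - m i) * ⟪v i, y⟫ = c * ⟪J (v i), J y⟫ := fun i y => by
    have h := hA (v i) y
    rw [hAv, real_inner_smul_left] at h
    linarith
  -- By `heig`, `‖J (v i)‖² = (1 - m i) / c`, so scaling by `s i` makes the images unit vectors. The
  -- same relation turns `m i ⟪v i, ·⟫` into `(c m i / (1 - m i)) ⟪J (v i), J ·⟫`, which is where
  -- the eigenvalue of `B` comes from.
  let s : Fin k → ℝ := fun i => Real.sqrt (c / (1 - m i))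
  have hs : ∀ i, 0 < s i := fun i => Real.sqrt_pos.2 (div_pos hc (h1m i))
  have hs2 : ∀ i, s i * s i = c / (1 - m i) := fun i =>
    Real.mul_self_sqrt (div_pos hc (h1m i)).le
  choose f hf using fun i => hseq (s i • v i)
  have hφ : ∀ i y, (1 - m i) * ⟪s i • v i, y⟫ = c * ⟪J (s i • v i), J y⟫ := fun i y => by
    rw [map_smul, real_inner_smul_left, real_inner_smul_left, mul_left_comm, heig]
    ring
  refine ⟨k, fun i => J (s i • v i), fun i => c * m i / (1 - m i), f, ?_, fun i => ?_, fun i => ?_,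
    fun i ε hε => ?_, fun i x => ?_, fun x hx => ?_⟩
  · rw [orthonormal_iff_ite]
    intro a b
    have h := hφ a (s b • v b)
    rw [real_inner_smul_left, real_inner_smul_right, orthonormal_iff_ite.1 hv] at h
    refine mul_left_cancel₀ hc.ne' (h.symm.trans ?_)
    rcases eq_or_ne a b with rfl | hab
    · have := (h1m a).ne'
      simp only [if_true, mul_one, hs2]
      field_simp
    · simp [hab]
  · exact div_neg_of_neg_of_pos (mul_neg_of_pos_of_neg hc (hm i)) (h1m i)
  · simpa only [Function.comp_def, hJ] using (J.continuous.tendsto _).comp (hf i)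
  · obtain ⟨N, hN⟩ := Metric.cauchySeq_iff.1 (hf i).cauchySeq (Real.sqrt ε) (Real.sqrt_pos.2 hε)
    refine ⟨N, fun a ha b hb => ?_⟩
    have h := hN a ha b hb
    rw [dist_eq_norm, ← map_sub, hjnorm, Real.lt_sqrt (norm_nonneg _), hnormsq] at h
    exact h
  · have h : Tendsto (fun m => B (f i m) x) atTop (𝓝 ⟪A (s i • v i), j x⟫) := by
      simp only [← hAj]
      exact ((A.continuous.tendsto _).comp (hf i)).inner tendsto_const_nhds
    convert h using 2
    have h2 := hφ i (j x)
    rw [hJ] at h2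
    rw [map_smul, hAv, smul_comm, real_inner_smul_left]
    have := (h1m i).ne'
    field_simp
    linear_combination (-m i) * h2
  · rw [← hAj]
    refine hnn _ fun i => ?_
    have h2 := hφ i (j x)
    rw [hJ, hx i, mul_zero, real_inner_smul_left] at h2
    exact ((mul_eq_zero.1 ((mul_eq_zero.1 h2).resolve_left (h1m i).ne')).resolve_left (hs i).ne')

end Friedrichs

/-! ### Consequences of finite index: lower bound and local coercivity. -/

namespace OnePhase

variable {n : ℕ} {u : EuclideanSpace ℝ (Fin n) → ℝ}

section Index

/-- Translates tuples into subspaces: a vanishing nontrivial combination would have `Q = 0` instead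
of `Q < 0`, so the tuple is independent and spans a negative subspace of dimension `k`. -/
theorem le_morseIndex (hu : IsGlobalClassicalSolution u) {k : ℕ} {x : Fin k → testFunctions u}
    (hx : IsNegDef fun i j => secondVariationForm hu (x i) (x j)) : (k : ℕ∞) ≤ morseIndex u := by
  set y : Fin k → EuclideanSpace ℝ (Fin n) → ℝ := fun i => x i
  have hsum : ∀ c : Fin k → ℝ, ((∑ i, c i • x i : testFunctions u) :
      EuclideanSpace ℝ (Fin n) → ℝ) = ∑ i, c i • y i := fun c => by
    simp [y]
  have hneg : ∀ c : Fin k → ℝ, c ≠ 0 →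
      secondVariation u (∑ i, c i • y i) (∑ i, c i • y i) < 0 := fun c hc => by
    have h := hx c hc
    rw [← bilinForm_sum_smul, secondVariationForm_apply, hsum] at h
    exact h
  have hli : LinearIndependent ℝ y := by
    rw [Fintype.linearIndependent_iff]
    intro c hc
    by_contra! hne
    obtain ⟨i, hi⟩ := hne
    have h := hneg c (fun h => hi (congr_fun h i))
    have h0 : secondVariation u (0 : EuclideanSpace ℝ (Fin n) → ℝ) 0 = 0 := by
      have := (secondVariationForm hu).map_zero₂ 0
      rwa [secondVariationForm_apply] at this
    rw [hc, h0] at h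
    exact lt_irrefl _ h
  refine le_iSup₂_of_le (Submodule.span ℝ (range y)) ⟨?_, fun φ hφ hφ0 => ?_⟩ ?_
  · rw [Submodule.span_le]
    rintro _ ⟨i, rfl⟩
    exact (x i).2
  · obtain ⟨c, rfl⟩ := (Submodule.mem_span_range_iff_exists_fun ℝ).1 hφ
    exact hneg c fun h => hφ0 (by simp [h])
  · rw [rank_span hli, Cardinal.mk_range_eq _ hli.injective]
    simp

theorem exists_negIndexLE (hu : IsGlobalClassicalSolution u) (h : morseIndex u < ⊤) :
    ∃ K, NegIndexLE (secondVariationForm hu) K := by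
  refine ⟨(morseIndex u).toNat, fun k x hx => ?_⟩
  have := le_morseIndex hu hx
  rw [← ENat.natCast_toNat h.ne] at this
  exact_mod_cast this

/-- Finite index forces nonnegativity of `Q` on the functions vanishing on a large ball. -/
theorem exists_nonneg_of_eq_zero_on_closedBall (hu : IsGlobalClassicalSolution u) {K : ℕ}
    (hK : NegIndexLE (secondVariationForm hu) K) : ∃ R : ℝ, ∀ φ ∈ testFunctions u,
      (∀ x ∈ Metric.closedBall 0 R, φ x = 0) → 0 ≤ secondVariation u φ φ := by
  obtain ⟨k, x, hx, hk⟩ := hK.exists_maximal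
  choose r hr0 hr using fun i => mem_ball_of_hasCompactSupport (x i).2.2.1
  -- The sum is a radius exceeding every `r i`. On the open ball `φ` vanishes identically and off it
  -- the `x i` do, so the integrands of `Q` vanish pointwise.
  refine ⟨∑ i, r i, fun φ hφ hφ0 => ?_⟩
  refine hk.nonneg_of_orthogonal (z := ⟨φ, hφ⟩) (fun _ _ => secondVariation_comm) hx fun i => ?_
  have hsub : tsupport (x i : EuclideanSpace ℝ (Fin n) → ℝ) ⊆ Metric.ball 0 (∑ i, r i) :=
    (hr i).trans (Metric.ball_subset_ball
      (Finset.single_le_sum (fun j _ => (hr0 j).le) (Finset.mem_univ i)))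
  rw [secondVariationForm_apply, secondVariation, sub_eq_zero]
  have h1 : ∀ y, ⟪∇ φ y, ∇ (x i : EuclideanSpace ℝ (Fin n) → ℝ) y⟫ = 0 := fun y => by
    by_cases hy : y ∈ Metric.ball (0 : EuclideanSpace ℝ (Fin n)) (∑ i, r i)
    · have : φ =ᶠ[𝓝 y] fun _ => 0 := by
        filter_upwards [Metric.isOpen_ball.mem_nhds hy] with z hz
        exact hφ0 z (Metric.ball_subset_closedBall hz)
      rw [this.gradient_eq]
      simp [gradient]
    · rw [gradient_eq_zero_of_notMem_tsupport fun h => hy (hsub h), inner_zero_right]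
  have h2 : ∀ y, meanCurvature u y * φ y * (x i : EuclideanSpace ℝ (Fin n) → ℝ) y = 0 := fun y => by
    by_cases hy : y ∈ Metric.ball (0 : EuclideanSpace ℝ (Fin n)) (∑ i, r i)
    · simp [hφ0 y (Metric.ball_subset_closedBall hy)]
    · simp [image_eq_zero_of_notMem_tsupport fun h => hy (hsub h)]
  simp [h1, h2]

end Index

section Coercivity

theorem integral_cutoff_sq_le (hu : IsGlobalClassicalSolution u)
    {η φ : EuclideanSpace ℝ (Fin n) → ℝ} (hη : ∀ x, η x ^ 2 ≤ 1) (hφ : φ ∈ testFunctions u) :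
    ∫ x, (η x * φ x) ^ 2 ∂(phaseMeasure u) ≤ ∫ x, φ x ^ 2 ∂(phaseMeasure u) := by
  simp only [mul_pow]
  simpa using integral_mul_sq_le hu (fun x => sq_nonneg (η x)) hη hφ

/-- Finite index implies that `Q` is bounded below relative to the `L²` norm. -/
theorem exists_lower_bound (hu : IsGlobalClassicalSolution u) {K : ℕ}
    (hK : NegIndexLE (secondVariationForm hu) K) : ∃ C : ℝ, 0 ≤ C ∧ ∀ φ ∈ testFunctions u,
      -C * ∫ x, φ x ^ 2 ∂(phaseMeasure u) ≤ secondVariation u φ φ := by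
  obtain ⟨R, hR⟩ := exists_nonneg_of_eq_zero_on_closedBall hu hK
  obtain ⟨η, ζ, R', C, hη, hζ, h1, hin, hout, hC0, hC⟩ :=
    exists_quadratic_partition (EuclideanSpace ℝ (Fin n)) R
  obtain ⟨C', hC'0, hC'⟩ := exists_garding hu R'
  refine ⟨C + C', by positivity, fun φ hφ => ?_⟩
  have h2 := secondVariation_localization hu hη hζ h1 hφ
  -- The outer piece `ζ φ` vanishes on the ball of radius `R`, the inner piece `η φ` lives in the
  -- ball of radius `R'`: finite index handles the first, Gårding the second.
  have h3 := hR _ (mul_mem_testFunctions hζ hφ) fun x hx => by simp [(hin x hx).2]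
  have h4 := hC' _ (mul_mem_testFunctions hη hφ) fun x hx => by simp [hout x hx]
  have h5 := integral_mul_sq_le hu (fun x => by positivity) hC hφ
  have h6 : 0 ≤ ∫ x, ‖∇ (fun x => η x * φ x) x‖ ^ 2 ∂(phaseMeasure u) :=
    integral_nonneg fun _ => by positivity
  have h7 := mul_le_mul_of_nonneg_left
    (integral_cutoff_sq_le hu (η := η) (fun x => by nlinarith [h1 x, sq_nonneg (ζ x)]) hφ) hC'0
  linarith

/-- The form norm controls the `H¹` norm and the boundary values on bounded sets. -/
theorem exists_local_coercivity (hu : IsGlobalClassicalSolution u) {K : ℝ} (hK0 : 0 ≤ K)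
    (hK : ∀ φ ∈ testFunctions u,
      -K * ∫ x, φ x ^ 2 ∂(phaseMeasure u) ≤ secondVariation u φ φ) (R : ℝ) :
    ∃ C : ℝ, 0 < C ∧ ∀ φ ∈ testFunctions u,
      ∫ x in Metric.closedBall 0 R, ‖∇ φ x‖ ^ 2 ∂(phaseMeasure u) ≤
        C * (secondVariation u φ φ + (K + 1) * ∫ x, φ x ^ 2 ∂(phaseMeasure u)) ∧
      ∫ x in Metric.closedBall 0 R, φ x ^ 2 ∂(bdryMeasure u) ≤
        C * (secondVariation u φ φ + (K + 1) * ∫ x, φ x ^ 2 ∂(phaseMeasure u)) := by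
  obtain ⟨η, ζ, R', C, hη, hζ, h1, hin, hout, hC0, hC⟩ :=
    -- The extra `1` gives `η = 1` on a neighbourhood of the closed ball of radius `R`, so the
    -- gradients of `η φ` and `φ` agree there.
    exists_quadratic_partition (EuclideanSpace ℝ (Fin n)) (R + 1)
  obtain ⟨C', hC'0, hC'⟩ := exists_garding hu R'
  obtain ⟨C'', hC''0, hC''⟩ := exists_trace_inequality_real hu R one_pos
  have hη1 : ∀ x, η x ^ 2 ≤ 1 := fun x => by nlinarith [h1 x, sq_nonneg (ζ x)]
  have hζ1 : ∀ x, ζ x ^ 2 ≤ 1 := fun x => by nlinarith [h1 x, sq_nonneg (η x)]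
  refine ⟨2 * (1 + C + C') + C'', by positivity, fun φ hφ => ?_⟩
  have hηφ := mul_mem_testFunctions hη hφ
  have h2 := secondVariation_localization hu hη hζ h1 hφ
  have h3 := hK _ (mul_mem_testFunctions hζ hφ)
  have h4 := hC' _ hηφ fun x hx => by simp [hout x hx]
  have h5 := integral_mul_sq_le hu (fun x => by positivity) hC hφ
  have h6 := integral_cutoff_sq_le hu hη1 hφ
  have h7 := integral_cutoff_sq_le hu hζ1 hφ
  have h8 := hK φ hφ
  have h9 := integral_sq_nonneg (phaseMeasure u) φ
  set L := ∫ x, φ x ^ 2 ∂(phaseMeasure u)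
  set S := secondVariation u φ φ + (K + 1) * L
  have hLS : L ≤ S := by simp only [S]; linarith
  have hS0 : 0 ≤ S := h9.trans hLS
  have h10 := mul_le_mul_of_nonneg_left h6 hC'0
  have h11 := mul_le_mul_of_nonneg_left h7 hK0
  -- Gårding bounds half of the energy of `η φ` by `Q(ηφ, ηφ) + C' L`; localization and the lower
  -- bound for `ζ φ` give `Q(ηφ, ηφ) ≤ Q(φ, φ) + (C + K) L`.
  have hgrad : ∫ x, ‖∇ (fun x => η x * φ x) x‖ ^ 2 ∂(phaseMeasure u) ≤
      2 * (1 + C + C') * S := by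
    have h12 := mul_le_mul_of_nonneg_left hLS hC0
    have h13 := mul_le_mul_of_nonneg_left hLS hC'0
    have h14 : secondVariation u φ φ + K * L ≤ S := by simp only [S]; linarith
    nlinarith
  have hball : Metric.closedBall (0 : EuclideanSpace ℝ (Fin n)) R ⊆ Metric.ball 0 (R + 1) :=
    Metric.closedBall_subset_ball (by linarith)
  have heq : ∀ x ∈ Metric.ball (0 : EuclideanSpace ℝ (Fin n)) (R + 1),
      η x * φ x = φ x := fun x hx => by
    rw [(hin x (Metric.ball_subset_closedBall hx)).1, one_mul]
  have hgeq : ∀ x ∈ Metric.closedBall (0 : EuclideanSpace ℝ (Fin n)) R,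
      ∇ (fun x => η x * φ x) x = ∇ φ x := fun x hx => by
    refine Filter.EventuallyEq.gradient_eq ?_
    filter_upwards [Metric.isOpen_ball.mem_nhds (hball hx)] with y hy using heq y hy
  constructor
  · calc ∫ x in Metric.closedBall 0 R, ‖∇ φ x‖ ^ 2 ∂(phaseMeasure u)
        = ∫ x in Metric.closedBall 0 R, ‖∇ (fun x => η x * φ x) x‖ ^ 2 ∂(phaseMeasure u) :=
          setIntegral_congr_fun measurableSet_closedBall fun x hx => by simp only [hgeq x hx]
      _ ≤ ∫ x, ‖∇ (fun x => η x * φ x) x‖ ^ 2 ∂(phaseMeasure u) :=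
          setIntegral_le_integral ((memLp_gradient hu hηφ 2).integrable_norm_pow (by norm_num))
            (ae_of_all _ fun _ => by simp only [Pi.zero_apply]; positivity)
      _ ≤ 2 * (1 + C + C') * S := hgrad
      _ ≤ _ := mul_le_mul_of_nonneg_right (by linarith) hS0
  · calc ∫ x in Metric.closedBall 0 R, φ x ^ 2 ∂(bdryMeasure u)
        = ∫ x in Metric.closedBall 0 R, (η x * φ x) ^ 2 ∂(bdryMeasure u) :=
          setIntegral_congr_fun measurableSet_closedBall fun x hx => by
            simp only [heq x (hball hx)]
      _ ≤ 1 * (∫ x, ‖∇ (fun x => η x * φ x) x‖ ^ 2 ∂(phaseMeasure u)) +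
          C'' * ∫ x, (η x * φ x) ^ 2 ∂(phaseMeasure u) := hC'' _ hηφ
      _ ≤ 2 * (1 + C + C') * S + C'' * S := by
          rw [one_mul]
          exact add_le_add hgrad (mul_le_mul_of_nonneg_left (h6.trans hLS) hC''0)
      _ = _ := by ring

end Coercivity

end OnePhase

/-! ### Convergence in `L²` and gluing of local limits. -/

section LocalL2

variable {α F : Type*} [MeasurableSpace α] [NormedAddCommGroup F] [InnerProductSpace ℝ F]
  {μ : Measure α}

theorem norm_toLp_sq_eq_integral {f : α → F} (hf : MemLp f 2 μ) :
    ‖hf.toLp f‖ ^ 2 = ∫ x, ‖f x‖ ^ 2 ∂μ := by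
  rw [← real_inner_self_eq_norm_sq, L2.inner_def]
  refine integral_congr_ae ?_
  filter_upwards [hf.coeFn_toLp] with x hx
  rw [hx, real_inner_self_eq_norm_sq]

theorem inner_toLp_eq_integral {f g : α → F} (hf : MemLp f 2 μ) (hg : MemLp g 2 μ) :
    ⟪hf.toLp f, hg.toLp g⟫ = ∫ x, ⟪f x, g x⟫ ∂μ := by
  rw [L2.inner_def]
  refine integral_congr_ae ?_
  filter_upwards [hf.coeFn_toLp, hg.coeFn_toLp] with x hx hx'
  rw [hx, hx']

/-- Continuity of the `L²` pairing. -/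
theorem tendsto_integral_inner {f g : ℕ → α → F} {f₀ g₀ : α → F} (hf : ∀ m, MemLp (f m) 2 μ)
    (hf₀ : MemLp f₀ 2 μ) (hg : ∀ m, MemLp (g m) 2 μ) (hg₀ : MemLp g₀ 2 μ)
    (hfl : Tendsto (fun m => eLpNorm (fun x => f m x - f₀ x) 2 μ) atTop (𝓝 0))
    (hgl : Tendsto (fun m => eLpNorm (fun x => g m x - g₀ x) 2 μ) atTop (𝓝 0)) :
    Tendsto (fun m => ∫ x, ⟪f m x, g m x⟫ ∂μ) atTop (𝓝 (∫ x, ⟪f₀ x, g₀ x⟫ ∂μ)) := by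
  simp only [← inner_toLp_eq_integral (hf _) (hg _), ← inner_toLp_eq_integral hf₀ hg₀]
  exact ((Lp.tendsto_Lp_iff_tendsto_eLpNorm'' f hf f₀ hf₀).2 hfl).inner
    ((Lp.tendsto_Lp_iff_tendsto_eLpNorm'' g hg g₀ hg₀).2 hgl)

theorem tendsto_integral_mul {f g : ℕ → α → ℝ} {f₀ g₀ : α → ℝ} (hf : ∀ m, MemLp (f m) 2 μ)
    (hf₀ : MemLp f₀ 2 μ) (hg : ∀ m, MemLp (g m) 2 μ) (hg₀ : MemLp g₀ 2 μ)
    (hfl : Tendsto (fun m => eLpNorm (fun x => f m x - f₀ x) 2 μ) atTop (𝓝 0))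
    (hgl : Tendsto (fun m => eLpNorm (fun x => g m x - g₀ x) 2 μ) atTop (𝓝 0)) :
    Tendsto (fun m => ∫ x, f m x * g m x ∂μ) atTop (𝓝 (∫ x, f₀ x * g₀ x ∂μ)) := by
  simpa [mul_comm] using tendsto_integral_inner hf hf₀ hg hg₀ hfl hgl

theorem exists_L2_limit [CompleteSpace F] {f : ℕ → α → F} (hf : ∀ m, MemLp (f m) 2 μ)
    (hC : ∀ ε : ℝ, 0 < ε → ∃ N, ∀ m ≥ N, ∀ m' ≥ N, ∫ x, ‖f m x - f m' x‖ ^ 2 ∂μ < ε) :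
    ∃ g : α → F, MemLp g 2 μ ∧
      Tendsto (fun m => eLpNorm (fun x => f m x - g x) 2 μ) atTop (𝓝 0) := by
  have hcs : CauchySeq fun m => (hf m).toLp (f m) := by
    rw [Metric.cauchySeq_iff]
    intro ε hε
    obtain ⟨N, hN⟩ := hC (ε ^ 2) (by positivity)
    refine ⟨N, fun m hm m' hm' => ?_⟩
    rw [dist_eq_norm, ← MemLp.toLp_sub]
    refine lt_of_pow_lt_pow_left₀ 2 hε.le ?_
    rw [norm_toLp_sq_eq_integral]
    exact hN m hm m' hm'
  obtain ⟨g, hg⟩ := cauchySeq_tendsto_of_complete hcs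
  refine ⟨g, Lp.memLp g, ?_⟩
  rw [← Lp.toLp_coeFn g (Lp.memLp g)] at hg
  exact (Lp.tendsto_Lp_iff_tendsto_eLpNorm'' f hf g (Lp.memLp g)).1 hg

end LocalL2

section Gluing

variable {E F : Type*} [NormedAddCommGroup E] [MeasurableSpace E] [OpensMeasurableSpace E]
  [NormedAddCommGroup F] [InnerProductSpace ℝ F] [CompleteSpace F] {μ : Measure E}

/-- A sequence which is Cauchy in `L²` of every ball converges in `L²` of every ball to a single
function. -/
theorem exists_local_L2_limit {f : ℕ → E → F} (hf : ∀ m, MemLp (f m) 2 μ)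
    (hC : ∀ R : ℝ, ∀ ε : ℝ, 0 < ε → ∃ N, ∀ m ≥ N, ∀ m' ≥ N,
      ∫ x in Metric.closedBall 0 R, ‖f m x - f m' x‖ ^ 2 ∂μ < ε) :
    ∃ g : E → F, ∀ R : ℝ, MemLp g 2 (μ.restrict (Metric.ball 0 R)) ∧
      Tendsto (fun m => eLpNorm (fun x => f m x - g x) 2 (μ.restrict (Metric.ball 0 R)))
        atTop (𝓝 0) := by
  have hlim := fun N : ℕ => exists_L2_limit (μ := μ.restrict (Metric.closedBall 0 (N : ℝ)))
    (fun m => (hf m).restrict _) (hC N)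
  choose G hG hGl using hlim
  have hcompat : ∀ N j : ℕ, j ≤ N →
      ∀ᵐ x ∂μ.restrict (Metric.closedBall 0 (N : ℝ)), x ∈ Metric.closedBall (0 : E) j →
        G j x = G N x := fun N j hj => by
    have hsub : Metric.closedBall (0 : E) j ⊆ Metric.closedBall 0 N :=
      Metric.closedBall_subset_closedBall (by exact_mod_cast hj)
    have hle : μ.restrict (Metric.closedBall (0 : E) (j : ℝ)) ≤
        μ.restrict (Metric.closedBall 0 (N : ℝ)) := Measure.restrict_mono hsub le_rfl
    have hGN : MemLp (G N) 2 (μ.restrict (Metric.closedBall (0 : E) (j : ℝ))) :=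
      (hG N).mono_measure hle
    have hGNl : Tendsto (fun m => eLpNorm (fun x => f m x - G N x) 2
        (μ.restrict (Metric.closedBall (0 : E) (j : ℝ)))) atTop (𝓝 0) :=
      tendsto_of_tendsto_of_tendsto_of_le_of_le tendsto_const_nhds (hGl N) (fun _ => zero_le)
        fun m => eLpNorm_mono_measure _ hle
    have h1 := (Lp.tendsto_Lp_iff_tendsto_eLpNorm'' f (fun m => (hf m).restrict _) _ (hG j)).2
      (hGl j)
    have h2 := (Lp.tendsto_Lp_iff_tendsto_eLpNorm'' f (fun m => (hf m).restrict _) _ hGN).2 hGNl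
    have h3 := (MemLp.toLp_eq_toLp_iff _ _).1 (tendsto_nhds_unique h1 h2)
    have h4 := (ae_restrict_iff' Metric.isClosed_closedBall.measurableSet).1 h3
    exact ae_restrict_of_ae h4
  -- At `x` the limit for the smallest ball of integer radius containing `x` is used; by `hcompat`
  -- it agrees almost everywhere with the limit for any larger integer ball.
  refine ⟨fun x => G ⌈‖x‖⌉₊ x, fun R => ?_⟩
  set N := ⌈R⌉₊
  have hle : μ.restrict (Metric.ball (0 : E) R) ≤ μ.restrict (Metric.closedBall 0 (N : ℝ)) :=
    Measure.restrict_mono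
      (Metric.ball_subset_closedBall.trans (Metric.closedBall_subset_closedBall (Nat.le_ceil R)))
      le_rfl
  have hae : (fun x => G ⌈‖x‖⌉₊ x) =ᵐ[μ.restrict (Metric.closedBall 0 (N : ℝ))] G N := by
    have h := ae_all_iff.2 fun j : ℕ => ae_all_iff.2 fun hj : j ≤ N => hcompat N j hj
    filter_upwards [h, ae_restrict_mem Metric.isClosed_closedBall.measurableSet] with x hx hxN
    rw [mem_closedBall_zero_iff] at hxN
    exact hx ⌈‖x‖⌉₊ (Nat.ceil_le.2 hxN) (mem_closedBall_zero_iff.2 (Nat.le_ceil _))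
  refine ⟨((memLp_congr_ae hae).2 (hG N)).mono_measure hle, ?_⟩
  refine tendsto_of_tendsto_of_tendsto_of_le_of_le tendsto_const_nhds (hGl N) (fun _ => zero_le)
    fun m => (eLpNorm_mono_measure _ hle).trans_eq (eLpNorm_congr_ae ?_)
  filter_upwards [hae] with x hx
  rw [hx]

end Gluing

/-! ### Construction of the negative Robin eigenfunctions. -/

namespace OnePhase

variable {n : ℕ} {u : EuclideanSpace ℝ (Fin n) → ℝ}

/-- Restriction of test functions to `Ω`, as a linear map to `L²(Ω)`. -/
noncomputable def restrictL2 (hu : IsGlobalClassicalSolution u) :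
    testFunctions u →ₗ[ℝ] L2Phase u where
  toFun φ := (memLp_phase hu φ.2 2).toLp φ
  map_add' φ ψ := MemLp.toLp_add (memLp_phase hu φ.2 2) (memLp_phase hu ψ.2 2)
  map_smul' c φ := MemLp.toLp_const_smul c (memLp_phase hu φ.2 2)

theorem norm_restrictL2_sq (hu : IsGlobalClassicalSolution u) (φ : testFunctions u) :
    ‖restrictL2 hu φ‖ ^ 2 = ∫ x, (φ : EuclideanSpace ℝ (Fin n) → ℝ) x ^ 2 ∂(phaseMeasure u) := by
  have := norm_toLp_sq_eq_integral (memLp_phase hu φ.2 2)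
  simp only [Real.norm_eq_abs, sq_abs] at this
  exact this

theorem inner_restrictL2 (hu : IsGlobalClassicalSolution u) (v : L2Phase u)
    (φ : testFunctions u) : ⟪v, restrictL2 hu φ⟫ =
      ∫ x, v x * (φ : EuclideanSpace ℝ (Fin n) → ℝ) x ∂(phaseMeasure u) := by
  rw [L2.inner_def]
  refine integral_congr_ae ?_
  filter_upwards [(memLp_phase hu φ.2 2).coeFn_toLp] with x hx
  simp only [restrictL2, LinearMap.coe_mk, AddHom.coe_mk, hx]
  simp [mul_comm]

/-- Continuity of the two parts of `Q` for convergence on a ball. -/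
theorem tendsto_form_of_tendsto_on_ball (hu : IsGlobalClassicalSolution u) (R : ℝ)
    {V W : ℕ → EuclideanSpace ℝ (Fin n) → EuclideanSpace ℝ (Fin n)}
    {V₀ W₀ : EuclideanSpace ℝ (Fin n) → EuclideanSpace ℝ (Fin n)}
    {s t : ℕ → EuclideanSpace ℝ (Fin n) → ℝ} {s₀ t₀ : EuclideanSpace ℝ (Fin n) → ℝ}
    (hV : ∀ m, MemLp (V m) 2 ((phaseMeasure u).restrict (Metric.ball 0 R)))
    (hV₀ : MemLp V₀ 2 ((phaseMeasure u).restrict (Metric.ball 0 R)))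
    (hW : ∀ m, MemLp (W m) 2 ((phaseMeasure u).restrict (Metric.ball 0 R)))
    (hW₀ : MemLp W₀ 2 ((phaseMeasure u).restrict (Metric.ball 0 R)))
    (hs : ∀ m, MemLp (s m) 2 ((bdryMeasure u).restrict (Metric.ball 0 R)))
    (hs₀ : MemLp s₀ 2 ((bdryMeasure u).restrict (Metric.ball 0 R)))
    (ht : ∀ m, MemLp (t m) 2 ((bdryMeasure u).restrict (Metric.ball 0 R)))
    (ht₀ : MemLp t₀ 2 ((bdryMeasure u).restrict (Metric.ball 0 R)))
    (hVl : Tendsto (fun m => eLpNorm (fun x => V m x - V₀ x) 2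
      ((phaseMeasure u).restrict (Metric.ball 0 R))) atTop (𝓝 0))
    (hWl : Tendsto (fun m => eLpNorm (fun x => W m x - W₀ x) 2
      ((phaseMeasure u).restrict (Metric.ball 0 R))) atTop (𝓝 0))
    (hsl : Tendsto (fun m => eLpNorm (fun x => s m x - s₀ x) 2
      ((bdryMeasure u).restrict (Metric.ball 0 R))) atTop (𝓝 0))
    (htl : Tendsto (fun m => eLpNorm (fun x => t m x - t₀ x) 2
      ((bdryMeasure u).restrict (Metric.ball 0 R))) atTop (𝓝 0)) :
    Tendsto (fun m => (∫ x in Metric.ball 0 R, ⟪V m x, W m x⟫ ∂(phaseMeasure u)) -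
        ∫ x in Metric.ball 0 R, meanCurvature u x * s m x * t m x ∂(bdryMeasure u)) atTop
      (𝓝 ((∫ x in Metric.ball 0 R, ⟪V₀ x, W₀ x⟫ ∂(phaseMeasure u)) -
        ∫ x in Metric.ball 0 R, meanCurvature u x * s₀ x * t₀ x ∂(bdryMeasure u))) := by
  obtain ⟨M, hM0, hM⟩ := exists_meanCurvature_bound hu R
  have hMae : ∀ᵐ x ∂(bdryMeasure u).restrict (Metric.ball 0 R), ‖meanCurvature u x‖ ≤ M := by
    have h : ∀ᵐ x ∂(bdryMeasure u), x ∈ freeBdry u :=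
      ae_restrict_mem isClosed_freeBdry.measurableSet
    filter_upwards [ae_restrict_of_ae h, ae_restrict_mem measurableSet_ball] with x hx hxR
    exact hM x ⟨hx, Metric.ball_subset_closedBall hxR⟩
  have hHm : AEStronglyMeasurable (meanCurvature u)
      ((bdryMeasure u).restrict (Metric.ball 0 R)) :=
    (aestronglyMeasurable_meanCurvature hu).restrict
  have hmem : ∀ {g : EuclideanSpace ℝ (Fin n) → ℝ},
      MemLp g 2 ((bdryMeasure u).restrict (Metric.ball 0 R)) →
      MemLp (fun x => meanCurvature u x * g x) 2 ((bdryMeasure u).restrict (Metric.ball 0 R)) :=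
    fun hg => MemLp.of_le_mul (c := M) hg (hHm.mul hg.1) (by
      filter_upwards [hMae] with x hx
      rw [norm_mul]
      exact mul_le_mul_of_nonneg_right hx (norm_nonneg _))
  refine (tendsto_integral_inner hV hV₀ hW hW₀ hVl hWl).sub
    (tendsto_integral_mul (fun m => hmem (hs m)) (hmem hs₀) ht ht₀ ?_ htl)
  have hlim := ENNReal.Tendsto.const_mul hsl (a := ENNReal.ofReal M) (Or.inr ENNReal.ofReal_ne_top)
  rw [mul_zero] at hlim
  refine tendsto_of_tendsto_of_tendsto_of_le_of_le tendsto_const_nhds hlim (fun _ => zero_le)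
    fun m => eLpNorm_le_mul_eLpNorm_of_ae_le_mul ?_ 2
  filter_upwards [hMae] with x hx
  rw [← mul_sub, norm_mul]
  exact mul_le_mul_of_nonneg_right hx (norm_nonneg _)

/-- The index is finite only if there is a finite-dimensional space of negative Robin
eigenfunctions on whose complement `Q` is nonnegative. -/
theorem exists_isNegativeEigenspan (hu : IsGlobalClassicalSolution u)
    (hfin : morseIndex u < ⊤) :
    ∃ V : Submodule ℝ (L2Phase u), IsNegativeEigenspan u V ∧ IsNonnegOnOrthogonal u V := by
  obtain ⟨K, hK⟩ := exists_negIndexLE hu hfin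
  obtain ⟨C, hC0, hC⟩ := exists_lower_bound hu hK
  -- The shift `C + 1` exceeds the lower bound by one, so the form norm dominates the `L²` norm.
  obtain ⟨k, φ, l, f, hφ, hl, hflim, hfC, hfB, hnn⟩ :=
    exists_generalized_negative_eigenbasis (B := secondVariationForm hu)
      (fun _ _ => secondVariation_comm) (restrictL2 hu) (c := C + 1) (by positivity)
      (fun ψ => by
        rw [norm_restrictL2_sq, secondVariationForm_apply]
        linarith [hC ψ ψ.2]) hK
  refine ⟨Submodule.span ℝ (range φ), ⟨k, φ, l, hφ, fun i => ⟨hl i, hφ.ne_zero i, ?_⟩, rfl⟩,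
    fun ψ hψ h => ?_⟩
  swap
  · refine hnn ⟨ψ, hψ⟩ fun i => ?_
    rw [inner_restrictL2]
    exact h _ (Submodule.subset_span ⟨i, rfl⟩)
  set g : ℕ → EuclideanSpace ℝ (Fin n) → ℝ := fun m => f i m
  have hg : ∀ m, g m ∈ testFunctions u := fun m => (f i m).2
  -- Local convergence of the gradients and of the boundary values.
  have hcauchy : ∀ R ε : ℝ, 0 < ε → ∃ N, ∀ m ≥ N, ∀ m' ≥ N,
      ∫ x in Metric.closedBall 0 R, ‖∇ (g m) x - ∇ (g m') x‖ ^ 2 ∂(phaseMeasure u) < ε ∧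
      ∫ x in Metric.closedBall 0 R, ‖g m x - g m' x‖ ^ 2 ∂(bdryMeasure u) < ε := by
    intro R ε hε
    obtain ⟨C', hC'0, hC'⟩ := exists_local_coercivity hu hC0 hC R
    obtain ⟨N, hN⟩ := hfC i (ε / C') (by positivity)
    refine ⟨N, fun m hm m' hm' => ?_⟩
    have h := hN m hm m' hm'
    rw [norm_restrictL2_sq, secondVariationForm_apply, lt_div_iff₀' hC'0] at h
    have h2 := hC' _ (f i m - f i m').2
    refine ⟨lt_of_le_of_lt (le_of_eq ?_) (h2.1.trans_lt h),
      lt_of_le_of_lt (le_of_eq ?_) (h2.2.trans_lt h)⟩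
    · refine integral_congr_ae (ae_restrict_of_ae (ae_phase_of_forall hu fun x hx => ?_))
      have hd := differentiableAt_of_mem_testFunctions hu (hg m) hx
      have hd' := differentiableAt_of_mem_testFunctions hu (hg m') hx
      have : ∇ (g m - g m') x = ∇ (g m) x - ∇ (g m') x := by
        rw [gradient, fderiv_sub hd hd', map_sub]; rfl
      simp only [Submodule.coe_sub]
      rw [← this]
    · refine integral_congr_ae (ae_of_all _ fun x => ?_)
      simp [g]
  obtain ⟨G, hG⟩ := exists_local_L2_limit (fun m => memLp_gradient hu (hg m) 2) fun R ε hε => by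
    obtain ⟨N, hN⟩ := hcauchy R ε hε
    exact ⟨N, fun m hm m' hm' => (hN m hm m' hm').1⟩
  obtain ⟨T, hT⟩ := exists_local_L2_limit (fun m => memLp_bdry hu (hg m) 2) fun R ε hε => by
    obtain ⟨N, hN⟩ := hcauchy R ε hε
    exact ⟨N, fun m hm m' hm' => (hN m hm m' hm').2⟩
  have hφl : Tendsto (fun m => eLpNorm (fun x => g m x - φ i x) 2 (phaseMeasure u)) atTop
      (𝓝 0) := by
    have h := hflim i
    rw [← Lp.toLp_coeFn (φ i) (Lp.memLp (φ i))] at h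
    exact (Lp.tendsto_Lp_iff_tendsto_eLpNorm'' g (fun m => memLp_phase hu (hg m) 2) _ _).1 h
  refine ⟨G, T, ⟨fun R => ⟨(Lp.memLp (φ i)).restrict _, (hG R).1, (hT R).1⟩, g, hg, fun R =>
    ⟨?_, (hG R).2, (hT R).2⟩⟩, fun ψ hψ => ?_⟩
  · exact tendsto_of_tendsto_of_tendsto_of_le_of_le tendsto_const_nhds hφl (fun _ => zero_le)
      fun m => eLpNorm_mono_measure _ Measure.restrict_le_self
  -- The support of `ψ` lies in one ball, where `Q(g m, ψ)` converges to the weak form of `(G, T)`;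
  -- `hfB` gives `l i ⟪φ i, ψ⟫` as the limit of the same sequence.
  · obtain ⟨R, hR0, hR⟩ := mem_ball_of_hasCompactSupport hψ.2.1
    have hzero : ∀ x ∉ Metric.ball (0 : EuclideanSpace ℝ (Fin n)) R, ψ x = 0 ∧ ∇ ψ x = 0 :=
      fun x hx => ⟨image_eq_zero_of_notMem_tsupport fun h => hx (hR h),
        gradient_eq_zero_of_notMem_tsupport fun h => hx (hR h)⟩
    have hlim := tendsto_form_of_tendsto_on_ball hu R
      (fun m => (memLp_gradient hu (hg m) 2).restrict _) (hG R).1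
      (fun _ => (memLp_gradient hu hψ 2).restrict _) ((memLp_gradient hu hψ 2).restrict _)
      (fun m => (memLp_bdry hu (hg m) 2).restrict _) (hT R).1
      (fun _ => (memLp_bdry hu hψ 2).restrict _) ((memLp_bdry hu hψ 2).restrict _)
      (hG R).2 (by simp) (hT R).2 (by simp)
    have hball : ∀ (V : EuclideanSpace ℝ (Fin n) → EuclideanSpace ℝ (Fin n))
        (s : EuclideanSpace ℝ (Fin n) → ℝ),
        (∫ x in Metric.ball 0 R, ⟪V x, ∇ ψ x⟫ ∂(phaseMeasure u)) -
          ∫ x in Metric.ball 0 R, meanCurvature u x * s x * ψ x ∂(bdryMeasure u) =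
        (∫ x, ⟪V x, ∇ ψ x⟫ ∂(phaseMeasure u)) -
          ∫ x, meanCurvature u x * s x * ψ x ∂(bdryMeasure u) := fun V s => by
      rw [setIntegral_eq_integral_of_forall_compl_eq_zero fun x hx => by simp [(hzero x hx).2],
        setIntegral_eq_integral_of_forall_compl_eq_zero fun x hx => by simp [(hzero x hx).1]]
    simp only [hball] at hlim
    have h := tendsto_nhds_unique hlim (hfB i ⟨ψ, hψ⟩)
    rwa [inner_restrictL2] at h

end OnePhase

/-! ### Comparison of the index with the number of eigenfunctions. -/

theorem tendsto_eLpNorm_zero_of_le_mul_add_mul {α F F₁ F₂ : Type*} [MeasurableSpace α]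
    [NormedAddCommGroup F] [NormedAddCommGroup F₁] [NormedAddCommGroup F₂] {μ : Measure α}
    {f : ℕ → α → F} {g : ℕ → α → F₁} {h : ℕ → α → F₂} {a b : ℝ}
    (hgm : ∀ m, AEStronglyMeasurable (g m) μ) (hhm : ∀ m, AEStronglyMeasurable (h m) μ)
    (ha : 0 ≤ a) (hb : 0 ≤ b) (hle : ∀ m, ∀ᵐ x ∂μ, ‖f m x‖ ≤ a * ‖g m x‖ + b * ‖h m x‖)
    (hg : Tendsto (fun m => eLpNorm (g m) 2 μ) atTop (𝓝 0))
    (hh : Tendsto (fun m => eLpNorm (h m) 2 μ) atTop (𝓝 0)) :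
    Tendsto (fun m => eLpNorm (f m) 2 μ) atTop (𝓝 0) := by
  have h1 := (ENNReal.Tendsto.const_mul hg (a := ENNReal.ofReal a)
    (Or.inr ENNReal.ofReal_ne_top)).add
    (ENNReal.Tendsto.const_mul hh (a := ENNReal.ofReal b) (Or.inr ENNReal.ofReal_ne_top))
  simp only [mul_zero, add_zero] at h1
  refine tendsto_of_tendsto_of_tendsto_of_le_of_le tendsto_const_nhds h1 (fun _ => zero_le)
    fun m => ?_
  calc eLpNorm (f m) 2 μ
      ≤ eLpNorm ((fun x => a * ‖g m x‖) + fun x => b * ‖h m x‖) 2 μ :=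
        eLpNorm_mono_ae (by
          filter_upwards [hle m] with x hx
          exact hx.trans (le_abs_self _))
    _ ≤ eLpNorm (fun x => a * ‖g m x‖) 2 μ + eLpNorm (fun x => b * ‖h m x‖) 2 μ :=
        eLpNorm_add_le ((hgm m).norm.const_mul a) ((hhm m).norm.const_mul b) (by norm_num)
    _ ≤ _ := by
        refine add_le_add (eLpNorm_le_mul_eLpNorm_of_ae_le_mul (ae_of_all _ fun x => ?_) 2)
          (eLpNorm_le_mul_eLpNorm_of_ae_le_mul (ae_of_all _ fun x => ?_) 2)
        · rw [norm_mul, norm_norm, Real.norm_of_nonneg ha]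
        · rw [norm_mul, norm_norm, Real.norm_of_nonneg hb]

theorem exists_bound_and_gradient_bound {E : Type*} [NormedAddCommGroup E]
    [InnerProductSpace ℝ E] [CompleteSpace E] {θ : E → ℝ} (hθ : ContDiff ℝ ∞ θ)
    (hc : HasCompactSupport θ) : ∃ a : ℝ, 0 ≤ a ∧ (∀ x, ‖θ x‖ ≤ a) ∧ ∀ x, ‖∇ θ x‖ ≤ a := by
  obtain ⟨a, ha⟩ := hθ.continuous.bounded_above_of_compact_support hc
  obtain ⟨b, hb⟩ := (continuous_gradient_of_contDiff hθ).bounded_above_of_compact_support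
    (HasCompactSupport.of_support_subset_isCompact hc.isCompact fun x hx => by
      by_contra h
      exact hx (gradient_eq_zero_of_notMem_tsupport h))
  exact ⟨max (max a b) 0, le_max_right _ _,
    fun x => (ha x).trans ((le_max_left _ _).trans (le_max_left _ _)),
    fun x => (hb x).trans ((le_max_right _ _).trans (le_max_left _ _))⟩

namespace OnePhase

variable {n : ℕ} {u : EuclideanSpace ℝ (Fin n) → ℝ}

/-- The sequence `f` of test functions approximates `φ`, its gradient `G` and its trace `T`
locally. -/
def IsLocalApprox (u φ : EuclideanSpace ℝ (Fin n) → ℝ)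
    (G : EuclideanSpace ℝ (Fin n) → EuclideanSpace ℝ (Fin n))
    (T : EuclideanSpace ℝ (Fin n) → ℝ) (f : ℕ → EuclideanSpace ℝ (Fin n) → ℝ) : Prop :=
  (∀ R : ℝ, MemLp φ 2 ((phaseMeasure u).restrict (Metric.ball 0 R)) ∧
    MemLp G 2 ((phaseMeasure u).restrict (Metric.ball 0 R)) ∧
    MemLp T 2 ((bdryMeasure u).restrict (Metric.ball 0 R))) ∧
  (∀ m, f m ∈ testFunctions u) ∧ ∀ R : ℝ,
    Tendsto (fun m => eLpNorm (fun x => f m x - φ x) 2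
      ((phaseMeasure u).restrict (Metric.ball 0 R))) atTop (𝓝 0) ∧
    Tendsto (fun m => eLpNorm (fun x => ∇ (f m) x - G x) 2
      ((phaseMeasure u).restrict (Metric.ball 0 R))) atTop (𝓝 0) ∧
    Tendsto (fun m => eLpNorm (fun x => f m x - T x) 2
      ((bdryMeasure u).restrict (Metric.ball 0 R))) atTop (𝓝 0)

theorem HasLocalGradientTrace.exists_isLocalApprox {φ T : EuclideanSpace ℝ (Fin n) → ℝ}
    {G : EuclideanSpace ℝ (Fin n) → EuclideanSpace ℝ (Fin n)}
    (h : HasLocalGradientTrace u φ G T) : ∃ f, IsLocalApprox u φ G T f := by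
  obtain ⟨h1, f, h2, h3⟩ := h
  exact ⟨f, h1, h2, h3⟩

section Cutoff

variable {φ φ' T T' θ η : EuclideanSpace ℝ (Fin n) → ℝ}
  {G G' : EuclideanSpace ℝ (Fin n) → EuclideanSpace ℝ (Fin n)}
  {f f' : ℕ → EuclideanSpace ℝ (Fin n) → ℝ} {l l' : ℝ}

/-- Convergence of `Q(fₘ, θ f'ₘ)` for approximations of a Robin eigenfunction and of another
function. -/
theorem IsLocalApprox.tendsto_secondVariation_cutoff (hu : IsGlobalClassicalSolution u)
    (h : IsLocalApprox u φ G T f) (h' : IsLocalApprox u φ' G' T' f')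
    (hweak : ∀ ψ ∈ testFunctions u, (∫ x, ⟪G x, ∇ ψ x⟫ ∂(phaseMeasure u)) -
      ∫ x, meanCurvature u x * T x * ψ x ∂(bdryMeasure u) =
        l * ∫ x, φ x * ψ x ∂(phaseMeasure u))
    (hθ : ContDiff ℝ ∞ θ) (hθc : HasCompactSupport θ) :
    Tendsto (fun m => secondVariation u (f m) (fun x => θ x * f' m x)) atTop
      (𝓝 (l * ∫ x, φ x * (θ x * φ' x) ∂(phaseMeasure u))) := by
  obtain ⟨R, hR0, hR⟩ := mem_ball_of_hasCompactSupport hθc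
  obtain ⟨a, ha0, ha, ha'⟩ := exists_bound_and_gradient_bound hθ hθc
  obtain ⟨h1, hf, hlim⟩ := h
  obtain ⟨h1', hf', hlim'⟩ := h'
  obtain ⟨-, hG, hT⟩ := h1 R
  obtain ⟨hφ', hG', hT'⟩ := h1' R
  obtain ⟨-, hGl, hTl⟩ := hlim R
  obtain ⟨hφl', hGl', hTl'⟩ := hlim' R
  have hg := fun m => mul_mem_testFunctions hθ (hf' m)
  have hθm : ∀ μ : Measure (EuclideanSpace ℝ (Fin n)), AEStronglyMeasurable θ μ :=
    fun μ => hθ.continuous.aestronglyMeasurable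
  have hθg : ∀ μ : Measure (EuclideanSpace ℝ (Fin n)), AEStronglyMeasurable (∇ θ) μ :=
    fun μ => (continuous_gradient_of_contDiff hθ).aestronglyMeasurable
  have hmulmem : ∀ {μ : Measure (EuclideanSpace ℝ (Fin n))} {v : EuclideanSpace ℝ (Fin n) → ℝ},
      MemLp v 2 μ → MemLp (fun x => θ x * v x) 2 μ := fun {μ v} hv =>
    MemLp.of_le_mul (c := a) hv ((hθm μ).mul hv.1) (ae_of_all _ fun x => by
      rw [norm_mul]
      exact mul_le_mul_of_nonneg_right (ha x) (norm_nonneg _))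
  have hW₀ : MemLp (fun x => θ x • G' x + φ' x • ∇ θ x) 2
      ((phaseMeasure u).restrict (Metric.ball 0 R)) := by
    refine MemLp.add (MemLp.of_le_mul (c := a) hG' ((hθm _).smul hG'.1) (ae_of_all _ fun x => ?_))
      (MemLp.of_le_mul (c := a) hφ' (hφ'.1.smul (hθg _)) (ae_of_all _ fun x => ?_))
    · rw [norm_smul]
      exact mul_le_mul_of_nonneg_right (ha x) (norm_nonneg _)
    · rw [norm_smul, mul_comm]
      exact mul_le_mul_of_nonneg_right (ha' x) (norm_nonneg _)
  have hWm : ∀ m, MemLp (∇ (fun x => θ x * f' m x)) 2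
      ((phaseMeasure u).restrict (Metric.ball 0 R)) := fun m =>
    (memLp_gradient hu (hg m) 2).restrict _
  have hWl : Tendsto (fun m => eLpNorm (fun x => ∇ (fun x => θ x * f' m x) x -
      (θ x • G' x + φ' x • ∇ θ x)) 2 ((phaseMeasure u).restrict (Metric.ball 0 R))) atTop (𝓝 0) := by
    refine tendsto_eLpNorm_zero_of_le_mul_add_mul
      (fun m => (((memLp_gradient hu (hf' m) 2).restrict _).sub hG').1)
      (fun m => (((memLp_phase hu (hf' m) 2).restrict _).sub hφ').1) ha0 ha0 (fun m => ?_) hGl' hφl'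
    refine ae_restrict_of_ae (ae_phase_of_forall hu fun x hx => ?_)
    rw [gradient_cutoff_mul hu hθ (hf' m) hx, add_sub_add_comm, ← smul_sub, ← sub_smul]
    refine (norm_add_le _ _).trans (add_le_add ?_ ?_)
    · rw [norm_smul]
      exact mul_le_mul_of_nonneg_right (ha x) (norm_nonneg _)
    · rw [norm_smul, mul_comm]
      exact mul_le_mul_of_nonneg_right (ha' x) (norm_nonneg _)
  have htl : ∀ {μ : Measure (EuclideanSpace ℝ (Fin n))} {v : EuclideanSpace ℝ (Fin n) → ℝ},
      (∀ m, MemLp (f' m) 2 μ) → MemLp v 2 μ →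
      Tendsto (fun m => eLpNorm (fun x => f' m x - v x) 2 μ) atTop (𝓝 0) →
      Tendsto (fun m => eLpNorm (fun x => θ x * f' m x - θ x * v x) 2 μ) atTop (𝓝 0) :=
    fun hfm hv hl => by
      refine tendsto_eLpNorm_zero_of_le_mul_add_mul (fun m => ((hfm m).sub hv).1)
        (fun m => ((hfm m).sub hv).1) ha0 le_rfl (fun m => ae_of_all _ fun x => ?_) hl hl
      rw [zero_mul, add_zero, ← mul_sub, norm_mul]
      exact mul_le_mul_of_nonneg_right (ha x) (norm_nonneg _)
  have hfb : ∀ m, MemLp (f' m) 2 ((bdryMeasure u).restrict (Metric.ball 0 R)) := fun m =>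
    (memLp_bdry hu (hf' m) 2).restrict _
  have hfp : ∀ m, MemLp (f' m) 2 ((phaseMeasure u).restrict (Metric.ball 0 R)) := fun m =>
    (memLp_phase hu (hf' m) 2).restrict _
  -- `hlim1` and `hlim2` have the same limit, the weak form of `(G, T)` against `θ φ'`. In `hlim2`
  -- the first argument stays fixed, so each term is given by the weak equation and `hlim3`
  -- identifies the limit.
  have hlim1 := tendsto_form_of_tendsto_on_ball hu R
    (fun m => (memLp_gradient hu (hf m) 2).restrict _) hG hWm hW₀
    (fun m => (memLp_bdry hu (hf m) 2).restrict _) hT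
    (fun m => hmulmem (hfb m)) (hmulmem hT') hGl hWl hTl (htl hfb hT' hTl')
  have hlim2 := tendsto_form_of_tendsto_on_ball hu R (fun _ => hG) hG hWm hW₀ (fun _ => hT) hT
    (fun m => hmulmem (hfb m)) (hmulmem hT') (by simp) hWl (by simp) (htl hfb hT' hTl')
  have hlim3 := (tendsto_integral_mul (fun _ => (h1 R).1) (h1 R).1 (fun m => hmulmem (hfp m))
    (hmulmem hφ') (by simp) (htl hfp hφ' hφl')).const_mul l
  have hzero : ∀ x ∉ Metric.ball (0 : EuclideanSpace ℝ (Fin n)) R, θ x = 0 := fun x hx =>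
    image_eq_zero_of_notMem_tsupport fun h => hx (hR h)
  have hgzero : ∀ m, ∀ x ∉ Metric.ball (0 : EuclideanSpace ℝ (Fin n)) R,
      ∇ (fun x => θ x * f' m x) x = 0 := fun m x hx =>
    gradient_eq_zero_of_notMem_tsupport fun h => hx (hR (tsupport_mul_subset_left h))
  have hball : ∀ (V : EuclideanSpace ℝ (Fin n) → EuclideanSpace ℝ (Fin n))
      (s : EuclideanSpace ℝ (Fin n) → ℝ) (m : ℕ),
      (∫ x in Metric.ball 0 R, ⟪V x, ∇ (fun x => θ x * f' m x) x⟫ ∂(phaseMeasure u)) -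
        ∫ x in Metric.ball 0 R, meanCurvature u x * s x * (θ x * f' m x) ∂(bdryMeasure u) =
      (∫ x, ⟪V x, ∇ (fun x => θ x * f' m x) x⟫ ∂(phaseMeasure u)) -
        ∫ x, meanCurvature u x * s x * (θ x * f' m x) ∂(bdryMeasure u) := fun V s m => by
    rw [setIntegral_eq_integral_of_forall_compl_eq_zero fun x hx => by simp [hgzero m x hx],
      setIntegral_eq_integral_of_forall_compl_eq_zero fun x hx => by simp [hzero x hx]]
  have hball' : ∀ v : EuclideanSpace ℝ (Fin n) → ℝ,
      ∫ x in Metric.ball 0 R, φ x * (θ x * v x) ∂(phaseMeasure u) =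
        ∫ x, φ x * (θ x * v x) ∂(phaseMeasure u) := fun v =>
    setIntegral_eq_integral_of_forall_compl_eq_zero fun x hx => by simp [hzero x hx]
  simp only [hball, hball'] at hlim1 hlim2 hlim3
  have hweak' := fun m => hweak _ (hg m)
  simp only [hweak'] at hlim2
  rw [tendsto_nhds_unique hlim2 hlim3] at hlim1
  exact hlim1

/-- By the cutoff identity, only `Q(f, η² f')`, its mirror image and the gradient-free error occur.
The limit thus involves the eigenfunctions only through `L²` pairings, whatever the growth of their
gradients and traces at infinity. -/
theorem IsLocalApprox.tendsto_secondVariation_cutoff_cutoff (hu : IsGlobalClassicalSolution u)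
    (h : IsLocalApprox u φ G T f) (h' : IsLocalApprox u φ' G' T' f')
    (hweak : ∀ ψ ∈ testFunctions u, (∫ x, ⟪G x, ∇ ψ x⟫ ∂(phaseMeasure u)) -
      ∫ x, meanCurvature u x * T x * ψ x ∂(bdryMeasure u) =
        l * ∫ x, φ x * ψ x ∂(phaseMeasure u))
    (hweak' : ∀ ψ ∈ testFunctions u, (∫ x, ⟪G' x, ∇ ψ x⟫ ∂(phaseMeasure u)) -
      ∫ x, meanCurvature u x * T' x * ψ x ∂(bdryMeasure u) =
        l' * ∫ x, φ' x * ψ x ∂(phaseMeasure u))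
    (hη : ContDiff ℝ ∞ η) (hηc : HasCompactSupport η) :
    Tendsto (fun m => secondVariation u (fun x => η x * f m x) (fun x => η x * f' m x)) atTop
      (𝓝 ((l + l') / 2 * (∫ x, η x ^ 2 * (φ x * φ' x) ∂(phaseMeasure u)) +
        ∫ x, ‖∇ η x‖ ^ 2 * (φ x * φ' x) ∂(phaseMeasure u))) := by
  have hη2 : ContDiff ℝ ∞ fun x => η x ^ 2 := hη.pow 2
  have hη2c : HasCompactSupport fun x => η x ^ 2 := by
    simp only [pow_two]
    exact hηc.mul_left (f := η)
  have h1 := h.tendsto_secondVariation_cutoff hu h' hweak hη2 hη2c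
  have h2 := h'.tendsto_secondVariation_cutoff hu h hweak' hη2 hη2c
  obtain ⟨R, hR0, hR⟩ := mem_ball_of_hasCompactSupport hηc
  obtain ⟨a, ha0, -, ha⟩ := exists_bound_and_gradient_bound hη hηc
  have ha2 : ∀ x, ‖‖∇ η x‖ ^ 2‖ ≤ a ^ 2 := fun x => by
    rw [norm_pow, norm_norm]
    exact pow_le_pow_left₀ (norm_nonneg _) (ha x) 2
  have hgm : ∀ μ : Measure (EuclideanSpace ℝ (Fin n)),
      AEStronglyMeasurable (fun x => ‖∇ η x‖ ^ 2) μ :=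
    fun μ => ((continuous_gradient_of_contDiff hη).norm.pow 2).aestronglyMeasurable
  have hmem : ∀ {v : EuclideanSpace ℝ (Fin n) → ℝ},
      MemLp v 2 ((phaseMeasure u).restrict (Metric.ball 0 R)) →
      MemLp (fun x => ‖∇ η x‖ ^ 2 * v x) 2 ((phaseMeasure u).restrict (Metric.ball 0 R)) :=
    fun hv => MemLp.of_le_mul (c := a ^ 2) hv ((hgm _).mul hv.1) (ae_of_all _ fun x => by
      rw [norm_mul]
      exact mul_le_mul_of_nonneg_right (ha2 x) (norm_nonneg _))
  have hfm := fun m => (memLp_phase hu (h.2.1 m) 2).restrict (Metric.ball 0 R)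
  have h3 := tendsto_integral_mul (fun m => hmem (hfm m)) (hmem (h.1 R).1)
    (fun m => (memLp_phase hu (h'.2.1 m) 2).restrict (Metric.ball 0 R)) (h'.1 R).1
    (by
      refine tendsto_eLpNorm_zero_of_le_mul_add_mul (fun m => ((hfm m).sub (h.1 R).1).1)
        (fun m => ((hfm m).sub (h.1 R).1).1) (sq_nonneg a) le_rfl
        (fun m => ae_of_all _ fun x => ?_) (h.2.2 R).1 (h.2.2 R).1
      rw [zero_mul, add_zero, ← mul_sub, norm_mul]
      exact mul_le_mul_of_nonneg_right (ha2 x) (norm_nonneg _)) (h'.2.2 R).1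
  have hball : ∀ v w : EuclideanSpace ℝ (Fin n) → ℝ,
      ∫ x in Metric.ball 0 R, ‖∇ η x‖ ^ 2 * v x * w x ∂(phaseMeasure u) =
        ∫ x, ‖∇ η x‖ ^ 2 * (v x * w x) ∂(phaseMeasure u) := fun v w => by
    simp only [← mul_assoc]
    exact setIntegral_eq_integral_of_forall_compl_eq_zero fun x hx => by
      simp [gradient_eq_zero_of_notMem_tsupport fun h => hx (hR h)]
  simp only [hball] at h3
  simp only [secondVariation_cutoff hu hη (h.2.1 _) (h'.2.1 _)]
  convert ((h1.add h2).div_const 2).add h3 using 2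
  have e1 : ∫ x, φ x * (η x ^ 2 * φ' x) ∂(phaseMeasure u) =
      ∫ x, η x ^ 2 * (φ x * φ' x) ∂(phaseMeasure u) :=
    integral_congr_ae (ae_of_all _ fun x => by ring)
  have e2 : ∫ x, φ' x * (η x ^ 2 * φ x) ∂(phaseMeasure u) =
      ∫ x, η x ^ 2 * (φ x * φ' x) ∂(phaseMeasure u) :=
    integral_congr_ae (ae_of_all _ fun x => by ring)
  rw [e1, e2]
  ring

end Cutoff

/-- Cutoff functions exhausting the space, with gradients tending uniformly to zero. -/
theorem exists_cutoff_sequence (E : Type*) [NormedAddCommGroup E] [InnerProductSpace ℝ E]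
    [FiniteDimensional ℝ E] : ∃ (η : ℕ → E → ℝ) (C : ℝ), (∀ N, ContDiff ℝ ∞ (η N)) ∧
      (∀ N, HasCompactSupport (η N)) ∧ (∀ N x, |η N x| ≤ 1) ∧
      (∀ x, Tendsto (fun N => η N x) atTop (𝓝 1)) ∧ (∀ N x, ‖∇ (η N) x‖ ≤ C) ∧
      ∀ x, Tendsto (fun N => ∇ (η N) x) atTop (𝓝 0) := by
  let χ : ContDiffBump (0 : E) := ⟨1, 2, one_pos, one_lt_two⟩
  have hχ : ContDiff ℝ ∞ χ := χ.contDiff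
  obtain ⟨C, hC0, -, hC⟩ := exists_bound_and_gradient_bound hχ χ.hasCompactSupport
  -- Dilating a fixed bump by `N + 1` divides its gradient by the same factor; the shift keeps `r 0`
  -- finite and nonzero.
  let r : ℕ → ℝ := fun N => ((N : ℝ) + 1)⁻¹
  have hr0 : ∀ N, 0 < r N := fun N => by positivity
  have hr : Tendsto r atTop (𝓝 0) := by
    simpa [r] using tendsto_one_div_add_atTop_nhds_zero_nat (𝕜 := ℝ)
  have hgrad : ∀ N x, ‖∇ (fun y => χ (r N • y)) x‖ ≤ r N * C := fun N x => by
    have h1 : HasFDerivAt (fun y : E => r N • y) (r N • ContinuousLinearMap.id ℝ E) x :=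
      (hasFDerivAt_id x).const_smul (r N)
    have h2 := ((hχ.differentiable (by simp)).differentiableAt
      (x := r N • x)).hasFDerivAt.comp x h1
    have h3 : fderiv ℝ (fun y => χ (r N • y)) x = r N • fderiv ℝ χ (r N • x) := by
      rw [show (fun y => χ (r N • y)) = χ ∘ fun y => r N • y from rfl, h2.fderiv]
      ext v
      simp
    rw [gradient, h3, map_smul, norm_smul, Real.norm_of_nonneg (hr0 N).le]
    exact mul_le_mul_of_nonneg_left (hC _) (hr0 N).le
  refine ⟨fun N y => χ (r N • y), C, fun N => hχ.comp (contDiff_const_smul (r N)), fun N => ?_,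
    fun N x => ?_, fun x => ?_, fun N x => ?_, fun x => ?_⟩
  · exact χ.hasCompactSupport.comp_homeomorph (Homeomorph.smulOfNeZero (r N) (hr0 N).ne')
  · rw [abs_of_nonneg χ.nonneg]
    exact χ.le_one
  · have h1 : Tendsto (fun N => r N • x) atTop (𝓝 0) := by simpa using hr.smul_const x
    have h2 := (hχ.continuous.tendsto 0).comp h1
    rwa [χ.one_of_mem_closedBall (Metric.mem_closedBall_self zero_le_one)] at h2
  · refine (hgrad N x).trans ?_
    have : r N ≤ 1 := inv_le_one_of_one_le₀ (by linarith [(Nat.cast_nonneg N : (0 : ℝ) ≤ N)])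
    nlinarith
  · refine squeeze_zero_norm (fun N => hgrad N x) ?_
    simpa using hr.mul_const C

/-- An orthonormal family of `k` Robin eigenfunctions with negative eigenvalues forces the index to
be at least `k`. -/
theorem le_morseIndex_of_orthonormal (hu : IsGlobalClassicalSolution u) {k : ℕ}
    {φ : Fin k → L2Phase u} {l : Fin k → ℝ} (hφ : Orthonormal ℝ φ) (hl : ∀ i, l i < 0)
    (he : ∀ i, IsRobinEigenfunction u (φ i) (l i)) : (k : ℕ∞) ≤ morseIndex u := by
  choose hφ0 G T hGT hweak using he
  choose f hf using fun i => (hGT i).exists_isLocalApprox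
  obtain ⟨η, C, hη, hηc, hη1, hηl, hηC, hηg⟩ :=
    exists_cutoff_sequence (EuclideanSpace ℝ (Fin n))
  have hint : ∀ i j, Integrable (fun x => φ i x * φ j x) (phaseMeasure u) := fun i j =>
    (Lp.memLp (φ i)).integrable_mul (Lp.memLp (φ j))
  have hδ : ∀ i j, ∫ x, φ i x * φ j x ∂(phaseMeasure u) = if i = j then 1 else 0 := fun i j => by
    rw [← orthonormal_iff_ite.1 hφ i j, L2.inner_def]
    exact integral_congr_ae (ae_of_all _ fun x => by simp [mul_comm])
  have hlim1 : ∀ i j, Tendsto (fun N => ∫ x, η N x ^ 2 * (φ i x * φ j x) ∂(phaseMeasure u)) atTop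
      (𝓝 (if i = j then 1 else 0)) := fun i j => by
    rw [← hδ]
    refine tendsto_integral_of_dominated_convergence (fun x => ‖φ i x * φ j x‖)
      (fun N => ((hη N).continuous.pow 2).aestronglyMeasurable.mul (hint i j).1) (hint i j).norm
      (fun N => ae_of_all _ fun x => ?_) (ae_of_all _ fun x => ?_)
    · rw [norm_mul, norm_pow, Real.norm_eq_abs]
      exact mul_le_of_le_one_left (norm_nonneg _) (pow_le_one₀ (abs_nonneg _) (hη1 N x))
    · simpa using ((hηl x).pow 2).mul_const (φ i x * φ j x)
  have hlim2 : ∀ i j, Tendsto (fun N => ∫ x, ‖∇ (η N) x‖ ^ 2 * (φ i x * φ j x) ∂(phaseMeasure u))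
      atTop (𝓝 0) := fun i j => by
    have h := tendsto_integral_of_dominated_convergence (μ := phaseMeasure u)
      (F := fun N x => ‖∇ (η N) x‖ ^ 2 * (φ i x * φ j x)) (f := fun _ => 0)
      (fun x => C ^ 2 * ‖φ i x * φ j x‖)
      (fun N => ((continuous_gradient_of_contDiff (hη N)).norm.pow 2).aestronglyMeasurable.mul
        (hint i j).1) ((hint i j).norm.const_mul _)
      (fun N => ae_of_all _ fun x => ?_) (ae_of_all _ fun x => ?_)
    · simpa using h
    · rw [norm_mul, norm_pow, norm_norm]
      exact mul_le_mul_of_nonneg_right (pow_le_pow_left₀ (norm_nonneg _) (hηC N x) 2)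
        (norm_nonneg _)
    · simpa using (((hηg x).norm).pow 2).mul_const (φ i x * φ j x)
  -- Two successive limits: the cutoff index `N` is fixed so that the limiting Gram matrix is close
  -- to `diag l`, and only then is `m` chosen so that genuine test functions realize it
  -- approximately.
  obtain ⟨N, hN⟩ := ((isNegDef_of_diagonal hl).eventually (l := atTop)
    (N := fun N i j => (l i + l j) / 2 * (∫ x, η N x ^ 2 * (φ i x * φ j x) ∂(phaseMeasure u)) +
      ∫ x, ‖∇ (η N) x‖ ^ 2 * (φ i x * φ j x) ∂(phaseMeasure u)) fun i j => by
    convert ((hlim1 i j).const_mul ((l i + l j) / 2)).add (hlim2 i j) using 2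
    split_ifs with hij
    · subst hij; ring
    · ring).exists
  obtain ⟨m, hm⟩ := (hN.eventually (l := atTop) fun i j =>
    (hf i).tendsto_secondVariation_cutoff_cutoff hu (hf j) (hweak i) (hweak j) (hη N)
      (hηc N)).exists
  exact le_morseIndex hu
    (x := fun i => ⟨fun x => η N x * f i m x, mul_mem_testFunctions (hη N) ((hf i).2.1 m)⟩) hm

/-- A nonzero element of a negative subspace in the kernel of all pairings with the `φ i` would be
orthogonal to their span, so `Q` would be both negative and nonnegative on it. The pairings thus
embed the subspace in `ℝ^k`. -/
theorem morseIndex_le_of_isNonnegOnOrthogonal (hu : IsGlobalClassicalSolution u) {k : ℕ}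
    {φ : Fin k → L2Phase u} (h : IsNonnegOnOrthogonal u (Submodule.span ℝ (range φ))) :
    morseIndex u ≤ k := by
  refine iSup₂_le fun W hW => ?_
  let g : W →ₗ[ℝ] (Fin k → ℝ) := LinearMap.pi fun i =>
    ((innerSL ℝ (φ i)).toLinearMap ∘ₗ restrictL2 hu) ∘ₗ Submodule.inclusion hW.1
  have hg : ∀ w i, g w i = ∫ x, φ i x * (w : EuclideanSpace ℝ (Fin n) → ℝ) x ∂(phaseMeasure u) :=
    fun w i => inner_restrictL2 hu (φ i) (Submodule.inclusion hW.1 w)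
  have hinj : Function.Injective g := by
    rw [injective_iff_map_eq_zero]
    intro w hw
    by_contra hw0
    refine (hW.2 w w.2 fun h0 => hw0 (Subtype.ext h0)).not_ge
      (h w (hW.1 w.2) fun v hv => ?_)
    let wt : testFunctions u := Submodule.inclusion hW.1 w
    have hv0 : ⟪v, restrictL2 hu wt⟫ = 0 := by
      refine Submodule.span_induction (p := fun v _ => ⟪v, restrictL2 hu wt⟫ = 0) ?_ ?_ ?_ ?_ hv
      · rintro _ ⟨i, rfl⟩
        exact congr_fun hw i
      · exact inner_zero_left _
      · intro a b _ _ ha hb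
        rw [inner_add_left, ha, hb, add_zero]
      · intro c a _ ha
        rw [real_inner_smul_left, ha, mul_zero]
    rwa [inner_restrictL2] at hv0
  have hrank := LinearMap.rank_le_of_injective g hinj
  rw [rank_fin_fun] at hrank
  simpa using Cardinal.toENat.monotone' hrank

end OnePhase

theorem proposition3p5 (n : ℕ) (hn : 1 ≤ n) (u : EuclideanSpace ℝ (Fin n) → ℝ)
    (hu : OnePhase.IsGlobalClassicalSolution u) (hconn : IsConnected (OnePhase.posPhase u)) :
    (OnePhase.morseIndex u < ⊤ ↔
      ∃ V : Submodule ℝ (OnePhase.L2Phase u),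
        OnePhase.IsNegativeEigenspan u V ∧ OnePhase.IsNonnegOnOrthogonal u V) ∧
    (OnePhase.morseIndex u < ⊤ → ∀ V : Submodule ℝ (OnePhase.L2Phase u),
      OnePhase.IsNegativeEigenspan u V → OnePhase.IsNonnegOnOrthogonal u V →
        OnePhase.morseIndex u = (Module.finrank ℝ V : ℕ∞)) := by
  refine ⟨⟨OnePhase.exists_isNegativeEigenspan hu, ?_⟩, fun _ V hV hnn => ?_⟩
  · rintro ⟨V, ⟨k, φ, l, -, -, rfl⟩, hnn⟩
    exact (OnePhase.morseIndex_le_of_isNonnegOnOrthogonal hu hnn).trans_lt (ENat.natCast_lt_top k)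
  · obtain ⟨k, φ, l, hφ, he, rfl⟩ := hV
    rw [finrank_span_eq_card hφ.linearIndependent, Fintype.card_fin]
    exact le_antisymm (OnePhase.morseIndex_le_of_isNonnegOnOrthogonal hu hnn)
      (OnePhase.le_morseIndex_of_orthonormal hu hφ (fun i => (he i).1) fun i => (he i).2)
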